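/- A clique coloring of a finite simple graph $G$ with $q$ colors is a map $V(G)\to\{1,\dots,q\}$ under which no inclusion-maximal clique of $G$ is monochromatic; 2-Clique Coloring asks whether a given graph has a clique coloring with $2$ colors. A linear forest is an acyclic graph all of whose components are paths, and the distance of $G$ to a linear forest is the least number of vertices whose deletion from $G$ leaves a linear forest. A problem with parameter $t$ is solvable in time $O^*(b^t)$ if there are a deterministic (multi-tape Turing machine) algorithm and constants $C,c$ such that every input $x$ with parameter value $t$ is decided correctly within $C\cdot b^{t}\cdot|x|^{c}$ steps. The Strong Exponential Time Hypothesis (SETH) states that for every $\varepsilon>0$ there is a $q$ such that $q$-SAT (satisfiability of CNF formulas with at most $q$ literals per clause) on $n$ variables is not solvable in time $O^*((2-\varepsilon)^n)$. **Theorem.** Assume SETH. Then for every $\varepsilon>0$: 1. 2-Clique Coloring is not solvable in time $O^*((2-\varepsilon)^t)$, where $t$ is the distance of the input graph to a linear forest; 2. 2-Clique Coloring is not solvable in time $O^*((2-\varepsilon)^t)$, where $t=\max\{\mathrm{pw}(G),\mathrm{fvs}(G)\}$ is the least number that bounds both the pathwidth and the feedback vertex set number of the input graph $G$. Both statements remain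 true if the algorithm receives, in addition to the graph, an integer $t$ that is at least the respective parameter of the graph, and its running time is measured in this $t$. -/

import Mathlib

/-! ### Graphs and their parameters -/

namespace SimpleGraph

variable {V : Type*}

/-- A coloring `f` is a clique coloring if no (inclusion-)maximal clique is monochromatic. -/
def IsCliqueColoring (G : SimpleGraph V) {q : ℕ} (f : V → Fin q) : Prop :=
  ∀ X : Set V, Maximal G.IsClique X → ¬ ∃ i : Fin q, ∀ v ∈ X, f v = i

/-- `G` has a clique coloring with `q` colors. -/
def CliqueColorable (G : SimpleGraph V) (q : ℕ) : Prop :=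
  ∃ f : V → Fin q, G.IsCliqueColoring f

/-- A linear forest: an acyclic graph all of whose components are paths, that is, an acyclic graph
of maximum degree at most two. -/
def IsLinearForest (G : SimpleGraph V) : Prop :=
  G.IsAcyclic ∧ ∀ v, (G.neighborSet v).encard ≤ 2

/-- The least number of vertices whose deletion turns `G` into a linear forest. -/
noncomputable def distToLinearForest (G : SimpleGraph V) : ℕ :=
  sInf {k | ∃ S : Finset V, S.card = k ∧ (G.induce {v | v ∉ S}).IsLinearForest}

/-- The least number of vertices whose deletion turns `G` into a forest. -/
noncomputable def feedbackVertexSetNumber (G : SimpleGraph V) : ℕ :=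
  sInf {k | ∃ S : Finset V, S.card = k ∧ (G.induce {v | v ∉ S}).IsAcyclic}

/-- The bags `B 0, …, B (m - 1)`, arranged along a path, form a path decomposition of `G`. -/
structure IsPathDecomposition (G : SimpleGraph V) {m : ℕ} (B : Fin m → Finset V) : Prop where
  vertex_mem : ∀ v, ∃ i, v ∈ B i
  edge_mem : ∀ u v, G.Adj u v → ∃ i, u ∈ B i ∧ v ∈ B i
  connected : ∀ v i j k, i ≤ j → j ≤ k → v ∈ B i → v ∈ B k → v ∈ B j

/-- The pathwidth of `G`: the least `w` such that `G` has a path decomposition whose bags have at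
most `w + 1` vertices (`0` for the graph without vertices). -/
noncomputable def pathwidth (G : SimpleGraph V) : ℕ :=
  sInf {w | ∃ (m : ℕ) (B : Fin m → Finset V), G.IsPathDecomposition B ∧ ∀ i, (B i).card ≤ w + 1}

end SimpleGraph

/-! ### Parameterized problems and running times -/

/-- A parameterized decision problem whose instances are written as bit strings. -/
structure ParamProblem where
  Instance : Type
  encode : Instance → List Bool
  yes : Instance → Prop
  param : Instance → ℕ

open Classical in
/-- The problem can be solved in time `O*(b ^ t)`, where `t` is the parameter: some deterministic
multi-tape (multi-stack) Turing machine gives the right answer on every instance `x`, as a single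
output bit, after at most `C * b ^ t * |x| ^ c` steps, with `C` and `c` constants and `|x|` the
length of the encoding of `x`. -/
def ParamProblem.SolvableInOStar (P : ParamProblem) (b : ℝ) : Prop :=
  ∃ (M : Turing.TM2ComputableAux Bool Bool) (C c : ℕ), ∀ x : P.Instance, ∃ T : ℕ,
    (T : ℝ) ≤ C * b ^ P.param x * ((P.encode x).length : ℝ) ^ c ∧
    Nonempty (Turing.TM2OutputsInTime M.tm
      ((P.encode x).map M.inputAlphabet.symm)
      (some ([decide (P.yes x)].map M.outputAlphabet.symm)) T)

/-- The number `n` in unary, followed by an end marker. -/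
def encodeUnary (n : ℕ) : List Bool := List.replicate n true ++ [false]

/-! ### Satisfiability and the Strong Exponential Time Hypothesis -/

/-- A formula in conjunctive normal form over the variables `0, …, numVars - 1`: a list of clauses,
each a list of literals. The literal `(x, true)` is `x`, the literal `(x, false)` is `¬ x`. -/
structure CNF where
  numVars : ℕ
  clauses : List (List (Fin numVars × Bool))

namespace CNF

/-- Some assignment makes at least one literal of every clause true. -/
def Satisfiable (φ : CNF) : Prop :=
  ∃ a : Fin φ.numVars → Bool, ∀ C ∈ φ.clauses, ∃ l ∈ C, a l.1 = l.2

/-- A clause: every literal is introduced by `1` and consists of its sign and its variable in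
unary; a `0` ends the clause. -/
def encodeClause {n : ℕ} (C : List (Fin n × Bool)) : List Bool :=
  (C.flatMap fun l => true :: l.2 :: encodeUnary l.1) ++ [false]

/-- A formula: the number of variables in unary, then the clauses, each introduced by `1`; a `0`
ends the formula. -/
def encode (φ : CNF) : List Bool :=
  encodeUnary φ.numVars ++ (φ.clauses.flatMap fun C => true :: encodeClause C) ++ [false]

end CNF

/-- `q`-SAT, parameterized by the number of variables: is a given formula whose clauses have at
most `q` literals satisfiable? -/
def kSAT (q : ℕ) : ParamProblem where
  Instance := {φ : CNF // ∀ C ∈ φ.clauses, C.length ≤ q}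
  encode φ := φ.1.encode
  yes φ := φ.1.Satisfiable
  param φ := φ.1.numVars

/-- The Strong Exponential Time Hypothesis: for every `ε > 0` there is a `q` such that `q`-SAT on
`n` variables cannot be solved in time `O*((2 - ε) ^ n)`. -/
def SETH : Prop :=
  ∀ ε : ℝ, 0 < ε → ∃ q : ℕ, ¬ (kSAT q).SolvableInOStar (2 - ε)

/-! ### Clique coloring as a parameterized problem -/

/-- A finite simple graph, given on the vertices `0, …, numVerts - 1`. -/
structure FinGraph where
  numVerts : ℕ
  graph : SimpleGraph (Fin numVerts)

open Classical in
/-- The number of vertices in unary, followed by the rows of the adjacency matrix. -/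
noncomputable def FinGraph.encode (G : FinGraph) : List Bool :=
  encodeUnary G.numVerts ++ (List.finRange G.numVerts).flatMap fun i =>
    (List.finRange G.numVerts).map fun j => decide (G.graph.Adj i j)

/-- `q`-Clique Coloring parameterized by the graph parameter `p`: the input is a graph `G`, and
running times are measured in `p G`. -/
noncomputable def cliqueColoring (q : ℕ) (p : FinGraph → ℕ) : ParamProblem where
  Instance := FinGraph
  encode G := G.encode
  yes G := G.graph.CliqueColorable q
  param G := p G

/-- `q`-Clique Coloring parameterized by the graph parameter `p`, where the value of the parameter
is part of the input: the input consists of a graph `G` and a number `t` such that `p G ≤ t`, and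
running times are measured in `t`. -/
noncomputable def cliqueColoringGiven (q : ℕ) (p : FinGraph → ℕ) : ParamProblem where
  Instance := {x : FinGraph × ℕ // p x.1 ≤ x.2}
  encode x := encodeUnary x.1.2 ++ x.1.1.encode
  yes x := x.1.1.graph.CliqueColorable q
  param x := x.1.2

/-! The proof is a reduction from `q`-SAT that works for every clause width `q` and takes a formula
with `n` variables to a graph whose parameters are at most `n + 5`. Solving clique coloring in time
`O*(b ^ t)` then solves `q`-SAT in time `O*(b' ^ n)` for every `b'` with `b ≤ b'` and `1 ≤ b' ≤ 2`,
since the additive five costs only a factor of at most 32. A base below two contradicts SETH.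

The gadget rests on one observation: an edge or a triangle whose vertices have no common neighbor is
a maximal clique, so it is not monochromatic. The graph contains a path through `R`, `S`, a block of
four vertices for every token (a literal occurrence or a clause end) and `z`. The edges `T R`, `R
S`, `S F` lie in no triangle, so `T` and `S` share one of the two colors and `R` and `F` have the
other; a variable counts as true if it has the color of `T`. In the block of a literal all path
edges lie in no triangle except one, the pair of the literal, which forms one triangle with the
variable and one with `T` (positive literal) or `F` (negative literal). If the pair is
monochromatic, its color differs from both apexes, so these agree and the literal is true. Hence a
path that enters the block with the color of `T` also leaves it with that color, unless the literal
is true; a true literal allows one change of parity.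

In the block of a clause end the path is interrupted. The edge to `T` before the gap forbids the
color of `T` just before the block, and the edge to `F` after the gap makes the next clause start
again with the color of `T`. So a clique coloring yields a true literal in every clause
(`exists_true_literal`). Conversely, a satisfying assignment gives a coloring that changes parity
exactly at the first true literal of each clause (`blockColor`, `color_chain`). There a
monochromatic maximal clique would have to be a pair on the path, but a pair can be enlarged by `T`
or `F` (`not_mono_of_maximal`). `P` and `Q` have different colors and are joined to each other and
to all variables; they prevent a variable without occurrences from being a maximal clique by itself.

Deleting the variables and `P`, `Q`, `T`, `F` leaves pieces of a path. This bounds the distance to a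
linear forest and the feedback vertex set number by `n + 4`, and the pathwidth by `n + 5`
(`IsPathOutside`).

Since running times refer to actual machines, the reduction is written as a stack program with an
explicit step count (`run_reduction`), compiled to `TM2` and run before the given machine
(`outputsInTime_prepend`). Its output is matched with the encoding of the graph in `encode_finGraph`
and `matrix_eq`. -/

/-! ### A small language of stack programs and its compilation to `TM2` -/

namespace StackProg

/-- The names of the stacks used by stack programs. -/
inductive Reg
  | inp | aux | out | num | row | var | sav | exc | tmp | lft | rgt
  deriving DecidableEq

instance : Fintype Reg :=
  Fintype.ofList [.inp, .aux, .out, .num, .row, .var, .sav, .exc, .tmp, .lft, .rgt]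
    fun r => by cases r <;> simp

/-- The contents of the stacks. -/
structure Store where
  inp : List Bool
  aux : List Bool
  out : List Bool
  num : List Bool
  row : List Bool
  var : List Bool
  sav : List Bool
  exc : List Bool
  tmp : List Bool
  lft : List Bool
  rgt : List Bool

namespace Store

/-- The contents of one stack. -/
def get (s : Store) : Reg → List Bool
  | .inp => s.inp
  | .aux => s.aux
  | .out => s.out
  | .num => s.num
  | .row => s.row
  | .var => s.var
  | .sav => s.sav
  | .exc => s.exc
  | .tmp => s.tmp
  | .lft => s.lft
  | .rgt => s.rgt

/-- Replace the contents of one stack. -/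
def set (s : Store) (r : Reg) (l : List Bool) : Store :=
  match r with
  | .inp => { s with inp := l }
  | .aux => { s with aux := l }
  | .out => { s with out := l }
  | .num => { s with num := l }
  | .row => { s with row := l }
  | .var => { s with var := l }
  | .sav => { s with sav := l }
  | .exc => { s with exc := l }
  | .tmp => { s with tmp := l }
  | .lft => { s with lft := l }
  | .rgt => { s with rgt := l }

/-- The store all of whose stacks but the input stack are empty. -/
def ofInput (l : List Bool) : Store := ⟨l, [], [], [], [], [], [], [], [], [], []⟩

/-- The store all of whose stacks but the output stack are empty. -/
def ofOutput (l : List Bool) : Store := ⟨[], [], l, [], [], [], [], [], [], [], []⟩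

theorem get_set (s : Store) (r : Reg) (l : List Bool) :
    (s.set r l).get = Function.update s.get r l := by
  funext r'
  cases r <;> cases r' <;> rfl

end Store

/-- Stack programs: `branch r a b` pops `r` and goes on with `a` if the popped symbol is `true` and
with `b` otherwise, `whileTrue r a` runs `a` as long as `true` is popped from `r`, and
`drain r a b` empties `r`, running `a` or `b` according to the popped symbols. -/
inductive Cmd
  | skip
  | push (r : Reg) (b : Bool)
  | seq (a b : Cmd)
  | branch (r : Reg) (a b : Cmd)
  | whileTrue (r : Reg) (a : Cmd)
  | drain (r : Reg) (a b : Cmd)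

/-- `Exec c s s' t`: the program `c`, started on the store `s`, ends with `s'` after `t` steps. -/
inductive Exec : Cmd → Store → Store → ℕ → Prop
  | skip (s) : Exec .skip s s 1
  | push (r b s) : Exec (.push r b) s (s.set r (b :: s.get r)) 1
  | seq {a b s s' s'' t t'} : Exec a s s' t → Exec b s' s'' t' → Exec (.seq a b) s s'' (t + t')
  | branchTrue {r a b s s' l t} : s.get r = true :: l → Exec a (s.set r l) s' t →
      Exec (.branch r a b) s s' (1 + t)
  | branchElse {r a b s s' t} : (s.get r).head? ≠ some true →
      Exec b (s.set r (s.get r).tail) s' t → Exec (.branch r a b) s s' (1 + t)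
  | whileNext {r a s s' s'' l t t'} : s.get r = true :: l → Exec a (s.set r l) s' t →
      Exec (.whileTrue r a) s' s'' t' → Exec (.whileTrue r a) s s'' (1 + t + t')
  | whileDone {r a s} : (s.get r).head? ≠ some true →
      Exec (.whileTrue r a) s (s.set r (s.get r).tail) 1
  | drainTrue {r a b s s' s'' l t t'} : s.get r = true :: l → Exec a (s.set r l) s' t →
      Exec (.drain r a b) s' s'' t' → Exec (.drain r a b) s s'' (1 + t + t')
  | drainFalse {r a b s s' s'' l t t'} : s.get r = false :: l → Exec b (s.set r l) s' t →
      Exec (.drain r a b) s' s'' t' → Exec (.drain r a b) s s'' (1 + t + t')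
  | drainDone {r a b s} : s.get r = [] → Exec (.drain r a b) s (s.set r []) 1

/-- The program points of a program. -/
def Cmd.Lab : Cmd → Type
  | .skip => Unit
  | .push _ _ => Unit
  | .seq a b => a.Lab ⊕ b.Lab
  | .branch _ a b => Option (a.Lab ⊕ b.Lab)
  | .whileTrue _ a => Option a.Lab
  | .drain _ a b => Option (a.Lab ⊕ b.Lab)

/-- There are finitely many program points. -/
@[reducible] def Cmd.labFintype : (c : Cmd) → Fintype c.Lab
  | .skip => inferInstanceAs (Fintype Unit)
  | .push _ _ => inferInstanceAs (Fintype Unit)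
  | .seq a b =>
    letI := a.labFintype
    letI := b.labFintype
    inferInstanceAs (Fintype (a.Lab ⊕ b.Lab))
  | .branch _ a b =>
    letI := a.labFintype
    letI := b.labFintype
    inferInstanceAs (Fintype (Option (a.Lab ⊕ b.Lab)))
  | .whileTrue _ a =>
    letI := a.labFintype
    inferInstanceAs (Fintype (Option a.Lab))
  | .drain _ a b =>
    letI := a.labFintype
    letI := b.labFintype
    inferInstanceAs (Fintype (Option (a.Lab ⊕ b.Lab)))

/-- The program point at which a program starts. -/
def Cmd.entry : (c : Cmd) → c.Lab
  | .skip => ()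
  | .push _ _ => ()
  | .seq a _ => Sum.inl a.entry
  | .branch _ _ _ => none
  | .whileTrue _ _ => none
  | .drain _ _ _ => none

section Compile

variable {K : Type} {Γ : K → Type} {Λ σ : Type}

/-- The stack alphabets of a machine extended by the stacks of stack programs. -/
abbrev ExtΓ (Γ : K → Type) : K ⊕ Reg → Type
  | .inl k => Γ k
  | .inr _ => Bool

/-- The stacks of the extended machine. -/
def join (S : ∀ k, List (Γ k)) (s : Store) : ∀ k : K ⊕ Reg, List (ExtΓ Γ k)
  | .inl k => S k
  | .inr r => s.get r

theorem update_join_inl [DecidableEq K] (S : ∀ k, List (Γ k)) (s : Store) (k : K)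
    (l : List (Γ k)) :
    Function.update (join S s) (.inl k) l = join (Function.update S k l) s := by
  funext k'
  rcases k' with k' | r
  · by_cases h : k' = k
    · subst h
      simp [join]
    · rw [Function.update_of_ne (by simpa using h)]
      simp only [join]
      rw [Function.update_of_ne h]
  · rw [Function.update_of_ne (by simp)]
    rfl

theorem update_join_inr [DecidableEq K] (S : ∀ k, List (Γ k)) (s : Store) (r : Reg)
    (l : List Bool) :
    Function.update (join S s) (.inr r) l = join S (s.set r l) := by
  funext k'
  rcases k' with k' | r'
  · rw [Function.update_of_ne (by simp)]
    rfl
  · simp only [join, Store.get_set]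
    by_cases h : r' = r
    · subst h
      simp
    · rw [Function.update_of_ne (by simpa using h), Function.update_of_ne h]
      rfl

/-- The code of a program, for an embedding of its program points into the labels of a machine and
a label at which to go on afterwards. -/
def Cmd.code : (c : Cmd) → (c.Lab → Λ) → Λ → c.Lab →
    Turing.TM2.Stmt (ExtΓ Γ) Λ (σ × Option Bool)
  | .skip, _, ex, _ => .goto fun _ => ex
  | .push r b, _, ex, _ => .push (.inr r) (fun _ => b) (.goto fun _ => ex)
  | .seq a b, emb, _, .inl l => a.code (fun x => emb (.inl x)) (emb (.inr b.entry)) l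
  | .seq _ b, emb, ex, .inr l => b.code (fun x => emb (.inr x)) ex l
  | .branch r a b, emb, _, none =>
    .pop (.inr r) (fun v o => (v.1, o))
      (.goto fun v => if v.2 = some true then emb (some (.inl a.entry))
        else emb (some (.inr b.entry)))
  | .branch _ a _, emb, ex, some (.inl l) => a.code (fun x => emb (some (.inl x))) ex l
  | .branch _ _ b, emb, ex, some (.inr l) => b.code (fun x => emb (some (.inr x))) ex l
  | .whileTrue r a, emb, ex, none =>
    .pop (.inr r) (fun v o => (v.1, o))
      (.goto fun v => if v.2 = some true then emb (some a.entry) else ex)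
  | .whileTrue _ a, emb, _, some l => a.code (fun x => emb (some x)) (emb none) l
  | .drain r a b, emb, ex, none =>
    .pop (.inr r) (fun v o => (v.1, o))
      (.goto fun v => if v.2 = some true then emb (some (.inl a.entry))
        else if v.2 = some false then emb (some (.inr b.entry)) else ex)
  | .drain _ a _, emb, _, some (.inl l) => a.code (fun x => emb (some (.inl x))) (emb none) l
  | .drain _ _ b, emb, _, some (.inr l) => b.code (fun x => emb (some (.inr x))) (emb none) l

/-- `StepsTo m n a b`: the machine `m` goes from `a` to `b` in `n` steps. -/
def StepsTo [DecidableEq K] (m : Λ → Turing.TM2.Stmt Γ Λ σ) (n : ℕ)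
    (a b : Turing.TM2.Cfg Γ Λ σ) : Prop :=
  (flip bind (Turing.TM2.step m))^[n] (some a) = some b

theorem StepsTo.trans [DecidableEq K] {m : Λ → Turing.TM2.Stmt Γ Λ σ} {n n' : ℕ}
    {a b c : Turing.TM2.Cfg Γ Λ σ} (h : StepsTo m n a b) (h' : StepsTo m n' b c) :
    StepsTo m (n + n') a c := by
  unfold StepsTo at *
  rw [add_comm, Function.iterate_add_apply, h, h']

theorem StepsTo.one [DecidableEq K] {m : Λ → Turing.TM2.Stmt Γ Λ σ} {l : Λ} {v : σ}
    {S : ∀ k, List (Γ k)} {b : Turing.TM2.Cfg Γ Λ σ} (h : Turing.TM2.stepAux (m l) v S = b) :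
    StepsTo m 1 ⟨some l, v, S⟩ b := by
  subst h
  rfl

/-- A pop of a program stack followed by a jump. -/
theorem stepsTo_pop [DecidableEq K]
    {m : Λ → Turing.TM2.Stmt (ExtΓ Γ) Λ (σ × Option Bool)} {l : Λ} {r : Reg}
    {f : σ × Option Bool → Λ}
    (h : m l = .pop (.inr r) (fun v o => (v.1, o)) (.goto f))
    (v : σ) (o : Option Bool) (S : ∀ k, List (Γ k)) (s : Store) :
    StepsTo m 1 ⟨some l, (v, o), join S s⟩
      ⟨some (f (v, (s.get r).head?)), (v, (s.get r).head?), join S (s.set r (s.get r).tail)⟩ := by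
  apply StepsTo.one
  rw [h]
  simp only [Turing.TM2.stepAux]
  rw [← update_join_inr]
  rfl

/-- The count in `Exec` charges one step per push, pop or skip, exactly the `TM2` steps of the
compiled code, and sequencing is free because the exit label of one part is the entry label of the
next. Quantifying over `emb` and `ex` is what lets the induction place subprograms inside larger
ones. The state `v` and the stacks `S` of the host machine are untouched; only the buffer of the
last popped symbol changes. -/
theorem Exec.stepsTo [DecidableEq K]
    {m : Λ → Turing.TM2.Stmt (ExtΓ Γ) Λ (σ × Option Bool)}
    {c : Cmd} {s s' : Store} {t : ℕ} (h : Exec c s s' t) :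
    ∀ (emb : c.Lab → Λ) (ex : Λ), (∀ l, m (emb l) = c.code emb ex l) →
      ∀ (v : σ) (o : Option Bool) (S : ∀ k, List (Γ k)), ∃ o',
        StepsTo m t ⟨some (emb c.entry), (v, o), join S s⟩ ⟨some ex, (v, o'), join S s'⟩ := by
  induction h with
  | skip s =>
    intro emb ex hm v o S
    refine ⟨o, StepsTo.one ?_⟩
    rw [hm]
    rfl
  | push r b s =>
    intro emb ex hm v o S
    refine ⟨o, StepsTo.one ?_⟩
    rw [hm, ← update_join_inr]
    rfl
  | seq _ _ iha ihb =>
    intro emb ex hm v o S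
    obtain ⟨o₁, h₁⟩ := iha _ _ (fun l => hm (.inl l)) v o S
    obtain ⟨o₂, h₂⟩ := ihb _ _ (fun l => hm (.inr l)) v o₁ S
    exact ⟨o₂, h₁.trans h₂⟩
  | @branchTrue _ _ _ s _ _ _ hr _ ih =>
    intro emb ex hm v o S
    have h₀ := stepsTo_pop (hm none) v o S s
    simp only [hr, List.head?_cons, List.tail_cons, if_true] at h₀
    obtain ⟨o₁, h₁⟩ := ih _ _ (fun l => hm (some (.inl l))) v _ S
    exact ⟨o₁, h₀.trans h₁⟩
  | @branchElse _ _ _ s _ _ hr _ ih =>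
    intro emb ex hm v o S
    have h₀ := stepsTo_pop (hm none) v o S s
    simp only [if_neg hr] at h₀
    obtain ⟨o₁, h₁⟩ := ih _ _ (fun l => hm (some (.inr l))) v _ S
    exact ⟨o₁, h₀.trans h₁⟩
  | @whileNext _ _ s _ _ _ _ _ hr _ _ ih ih' =>
    intro emb ex hm v o S
    have h₀ := stepsTo_pop (hm none) v o S s
    simp only [hr, List.head?_cons, List.tail_cons, if_true] at h₀
    obtain ⟨o₁, h₁⟩ := ih _ _ (fun l => hm (some l)) v _ S
    obtain ⟨o₂, h₂⟩ := ih' emb ex hm v o₁ S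
    exact ⟨o₂, (h₀.trans h₁).trans h₂⟩
  | @whileDone _ _ s hr =>
    intro emb ex hm v o S
    have h₀ := stepsTo_pop (hm none) v o S s
    simp only [if_neg hr] at h₀
    exact ⟨_, h₀⟩
  | @drainTrue _ _ _ s _ _ _ _ _ hr _ _ ih ih' =>
    intro emb ex hm v o S
    have h₀ := stepsTo_pop (hm none) v o S s
    simp only [hr, List.head?_cons, List.tail_cons, if_true] at h₀
    obtain ⟨o₁, h₁⟩ := ih _ _ (fun l => hm (some (.inl l))) v _ S
    obtain ⟨o₂, h₂⟩ := ih' emb ex hm v o₁ S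
    exact ⟨o₂, (h₀.trans h₁).trans h₂⟩
  | @drainFalse _ _ _ s _ _ _ _ _ hr _ _ ih ih' =>
    intro emb ex hm v o S
    have h₀ := stepsTo_pop (hm none) v o S s
    simp only [hr, List.head?_cons, List.tail_cons, Option.some.injEq, Bool.false_eq_true,
      if_false, if_true] at h₀
    obtain ⟨o₁, h₁⟩ := ih _ _ (fun l => hm (some (.inr l))) v _ S
    obtain ⟨o₂, h₂⟩ := ih' emb ex hm v o₁ S
    exact ⟨o₂, (h₀.trans h₁).trans h₂⟩
  | @drainDone _ _ _ s hr =>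
    intro emb ex hm v o S
    have h₀ := stepsTo_pop (hm none) v o S s
    simp only [hr, List.head?_nil, List.tail_nil, reduceCtorEq, if_false] at h₀
    exact ⟨_, h₀⟩

end Compile

/-! ### Running a program before a machine -/

section Prepend

open Turing

/-- The statement of a machine, as a statement of the machine extended by program stacks. -/
def liftStmt {K : Type} {Γ : K → Type} {Λ Λ' σ : Type} (emb : Λ → Λ') :
    TM2.Stmt Γ Λ σ → TM2.Stmt (ExtΓ Γ) Λ' (σ × Option Bool)
  | .push k f q => .push (.inl k) (fun v => f v.1) (liftStmt emb q)
  | .peek k f q => .peek (.inl k) (fun v a => (f v.1 a, v.2)) (liftStmt emb q)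
  | .pop k f q => .pop (.inl k) (fun v a => (f v.1 a, v.2)) (liftStmt emb q)
  | .load f q => .load (fun v => (f v.1, v.2)) (liftStmt emb q)
  | .branch f q q' => .branch (fun v => f v.1) (liftStmt emb q) (liftStmt emb q')
  | .goto f => .goto fun v => emb (f v.1)
  | .halt => .halt

/-- A configuration of a machine, as a configuration of the extended machine. -/
def liftCfg {K : Type} {Γ : K → Type} {Λ Λ' σ : Type} (emb : Λ → Λ') (o : Option Bool)
    (s : Store) (c : TM2.Cfg Γ Λ σ) : TM2.Cfg (ExtΓ Γ) Λ' (σ × Option Bool) :=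
  ⟨c.l.map emb, (c.var, o), join c.stk s⟩

theorem stepAux_liftStmt {K : Type} [DecidableEq K] {Γ : K → Type} {Λ Λ' σ : Type} (emb : Λ → Λ')
    (o : Option Bool) (s : Store) (q : TM2.Stmt Γ Λ σ) (v : σ) (S : ∀ k, List (Γ k)) :
    TM2.stepAux (liftStmt emb q) (v, o) (join S s) = liftCfg emb o s (TM2.stepAux q v S) := by
  induction q generalizing v S with
  | push k f q ih =>
    simp only [liftStmt, TM2.stepAux]
    rw [← ih, ← update_join_inl]
    rfl
  | peek k f q ih =>
    simp only [liftStmt, TM2.stepAux]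
    rw [← ih]
    rfl
  | pop k f q ih =>
    simp only [liftStmt, TM2.stepAux]
    rw [← ih, ← update_join_inl]
    rfl
  | load f q ih => simp only [liftStmt, TM2.stepAux, ih]
  | branch f q q' ih ih' =>
    simp only [liftStmt, TM2.stepAux, ih, ih']
    cases f v <;> rfl
  | goto f => rfl
  | halt => rfl

theorem iterate_bind_none {α : Type*} (f : α → Option α) (n : ℕ) :
    (flip bind f)^[n] none = none := by
  induction n with
  | zero => rfl
  | succ n ih => rw [Function.iterate_succ_apply]; exact ih

theorem StepsTo.liftCfg {K : Type} [DecidableEq K] {Γ : K → Type} {Λ Λ' σ : Type} {emb : Λ → Λ'}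
    {m : Λ → TM2.Stmt Γ Λ σ} {m' : Λ' → TM2.Stmt (ExtΓ Γ) Λ' (σ × Option Bool)}
    (hm : ∀ l, m' (emb l) = liftStmt emb (m l)) (o : Option Bool) (s : Store) {n : ℕ}
    {a b : TM2.Cfg Γ Λ σ} (h : StepsTo m n a b) :
    StepsTo m' n (liftCfg emb o s a) (liftCfg emb o s b) := by
  induction n generalizing a with
  | zero =>
    simp only [StepsTo, Function.iterate_zero, id, Option.some.injEq] at h ⊢
    rw [h]
  | succ n ih =>
    simp only [StepsTo, Function.iterate_succ_apply] at h ih ⊢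
    obtain ⟨_ | l, v, S⟩ := a
    -- A halted configuration has no successor, so it cannot be the start of a positive number of
    -- steps.
    · have : (flip bind (TM2.step m)) (some ⟨none, v, S⟩) = none := rfl
      rw [this, iterate_bind_none] at h
      cases h
    · have h₁ : (flip bind (TM2.step m)) (some ⟨some l, v, S⟩) = some (TM2.stepAux (m l) v S) := rfl
      rw [h₁] at h
      rw [← ih h, ← stepAux_liftStmt, ← hm]
      rfl

/-- The label at which the output of the program is moved to the input stack of the machine. -/
abbrev prependLab (tm : FinTM2) (c : Cmd) : Type := tm.Λ ⊕ Option c.Lab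

open TM2.Stmt in
/-- The code of the machine that runs the program `c` and then the machine `tm` on the output. -/
def prependCode (tm : FinTM2) (e : tm.Γ tm.k₀ ≃ Bool) (c : Cmd) :
    prependLab tm c → TM2.Stmt (ExtΓ tm.Γ) (prependLab tm c) (tm.σ × Option Bool)
  | .inl l => liftStmt .inl (tm.m l)
  | .inr (some l) => c.code (fun x => .inr (some x)) (.inr none) l
  | .inr none =>
    pop (.inr .out) (fun v o => (v.1, o))
      (branch (fun v => v.2.isSome)
        (push (.inl tm.k₀) (fun v => e.symm (v.2.getD false)) (goto fun _ => .inr none))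
        (goto fun _ => .inl tm.main))

/-- The machine that runs the program `c` and then the machine `tm` on the output. -/
def prependTM (tm : FinTM2) (e : tm.Γ tm.k₀ ≃ Bool) (c : Cmd) : FinTM2 :=
  letI := tm.kDecidableEq
  letI := tm.kFin
  letI := tm.ΛFin
  letI := tm.σFin
  letI := c.labFintype
  { K := tm.K ⊕ Reg
    k₀ := .inr .inp
    k₁ := .inl tm.k₁
    Γ := ExtΓ tm.Γ
    Λ := prependLab tm c
    main := .inr (some c.entry)
    σ := tm.σ × Option Bool
    initialState := (tm.initialState, none)
    Γk₀Fin := inferInstanceAs (Fintype Bool)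
    m := prependCode tm e c }

/-- Popping from one stack and pushing to the other reverses the word, which is why programs are
required to leave `y.reverse` on `out`. The last step pops from the empty stack and so resets the
buffer to `none`, its value in the initial state, which a halting configuration must also show. -/
theorem stepsTo_transfer (tm : FinTM2) (e : tm.Γ tm.k₀ ≃ Bool) (c : Cmd) (l : List Bool)
    (v : tm.σ) (o : Option Bool) (S : ∀ k, List (tm.Γ k)) :
    letI := tm.kDecidableEq
    StepsTo (prependCode tm e c) (l.length + 1) ⟨some (.inr none), (v, o), join S (.ofOutput l)⟩
      ⟨some (.inl tm.main), (v, none),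
        join (Function.update S tm.k₀ ((l.reverse.map e.symm) ++ S tm.k₀)) (.ofOutput [])⟩ := by
  let := tm.kDecidableEq
  induction l generalizing o S with
  | nil =>
    apply StepsTo.one
    simp only [prependCode, TM2.stepAux, List.reverse_nil, List.map_nil, List.nil_append,
      Function.update_eq_self]
    have : Function.update (join S (.ofOutput [])) (.inr .out)
        (join S (.ofOutput []) (.inr .out)).tail = join S (.ofOutput []) := by
      rw [update_join_inr]
      rfl
    rw [this]
    rfl
  | cons b l ih =>
    have h₁ : StepsTo (prependCode tm e c) 1 ⟨some (.inr none), (v, o), join S (.ofOutput (b :: l))⟩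
        ⟨some (.inr none), (v, some b),
          join (Function.update S tm.k₀ (e.symm b :: S tm.k₀)) (.ofOutput l)⟩ := by
      apply StepsTo.one
      simp only [prependCode, TM2.stepAux]
      have : Function.update (join S (.ofOutput (b :: l))) (.inr .out)
          (join S (.ofOutput (b :: l)) (.inr .out)).tail = join S (.ofOutput l) := by
        rw [update_join_inr]
        rfl
      rw [this, ← update_join_inl]
      rfl
    have h₂ := h₁.trans (ih (some b) (Function.update S tm.k₀ (e.symm b :: S tm.k₀)))
    rw [List.length_cons, add_comm]
    simpa using h₂

/-- Running a program before a machine: the times add up. -/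
theorem outputsInTime_prepend (M : TM2ComputableAux Bool Bool) (c : Cmd) {x y : List Bool} {t : ℕ}
    (hc : Exec c (.ofInput x) (.ofOutput y.reverse) t) {z : List Bool} {T : ℕ}
    (hM : Nonempty (TM2OutputsInTime M.tm (y.map M.inputAlphabet.symm)
      (some (z.map M.outputAlphabet.symm)) T)) :
    Nonempty (TM2OutputsInTime (prependTM M.tm M.inputAlphabet c) x
      (some (z.map M.outputAlphabet.symm)) (t + (y.length + 1) + T)) := by
  let := M.tm.kDecidableEq
  obtain ⟨⟨n, hn⟩, hT⟩ := hM
  have hi : initList (prependTM M.tm M.inputAlphabet c) x =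
      ⟨some (.inr (some c.entry)), (M.tm.initialState, none),
        join (fun _ => []) (.ofInput x)⟩ := by
    refine congrArg _ (funext fun k => ?_)
    rcases k with k | r
    · rfl
    · cases r <;> rfl
  have hi' : liftCfg (Sum.inl : M.tm.Λ → prependLab M.tm c) none (.ofOutput [])
      (initList M.tm (y.map M.inputAlphabet.symm)) =
      ⟨some (.inl M.tm.main), (M.tm.initialState, none),
        join (Function.update (fun _ => []) M.tm.k₀ (y.map M.inputAlphabet.symm))
          (.ofOutput [])⟩ := by
    refine congrArg (fun S => TM2.Cfg.mk _ _ (join S _)) (funext fun k => ?_)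
    by_cases h : k = M.tm.k₀
    · subst h
      simp [initList]
    · rw [Function.update_of_ne h]
      simp [initList, h]
  -- A halting configuration has all stacks but the output empty. This is why programs have to end
  -- in a store of the form `ofOutput`, with every working stack cleared.
  have hh : liftCfg (Sum.inl : M.tm.Λ → prependLab M.tm c) none (.ofOutput [])
      (haltList M.tm (z.map M.outputAlphabet.symm)) =
      haltList (prependTM M.tm M.inputAlphabet c) (z.map M.outputAlphabet.symm) := by
    refine congrArg _ (funext fun k => ?_)
    rcases k with k | r
    · by_cases h : k = M.tm.k₁
      · subst h
        simp [join, haltList, prependTM]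
        rfl
      · have : ¬ ((Sum.inl k : M.tm.K ⊕ Reg) = Sum.inl M.tm.k₁) := by simpa using h
        simp [join, haltList, prependTM, h]
    · cases r <;> rfl
  obtain ⟨o, h₁⟩ := hc.stepsTo (m := prependCode M.tm M.inputAlphabet c)
    (fun x => .inr (some x)) (.inr none) (fun _ => rfl) M.tm.initialState none (fun _ => [])
  have h₂ := stepsTo_transfer M.tm M.inputAlphabet c y.reverse M.tm.initialState o (fun _ => [])
  have h₃ : StepsTo M.tm.m n (initList M.tm (y.map M.inputAlphabet.symm))
      (haltList M.tm (z.map M.outputAlphabet.symm)) := hn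
  have h₄ := h₃.liftCfg (m' := prependCode M.tm M.inputAlphabet c) (emb := Sum.inl)
    (fun _ => rfl) none (.ofOutput [])
  rw [hi', hh] at h₄
  simp only [List.reverse_reverse, List.append_nil, List.length_reverse] at h₂
  have h₅ := (h₁.trans h₂).trans h₄
  refine ⟨⟨⟨t + (y.length + 1) + n, ?_⟩, by simpa using hT⟩⟩
  rw [hi]
  exact h₅

end Prepend

end StackProg

namespace StackProg

/-! ### Programs with time bounds -/

/-- The program `c` takes the store `s` to `s'` in at most `T` steps. -/
def Run (c : Cmd) (s s' : Store) (T : ℕ) : Prop := ∃ t ≤ T, Exec c s s' t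

namespace Run

theorem congr {c : Cmd} {s s' s'' : Store} {T T' : ℕ} (h : Run c s s' T) (hs : s' = s'')
    (hT : T ≤ T') : Run c s s'' T' := by
  obtain ⟨t, ht, h⟩ := h
  exact ⟨t, ht.trans hT, hs ▸ h⟩

theorem mono {c : Cmd} {s s' : Store} {T T' : ℕ} (h : Run c s s' T) (hT : T ≤ T') :
    Run c s s' T' := h.congr rfl hT

theorem skip (s : Store) : Run .skip s s 1 := ⟨1, le_rfl, .skip s⟩

theorem push (r : Reg) (b : Bool) (s : Store) :
    Run (.push r b) s (s.set r (b :: s.get r)) 1 := ⟨1, le_rfl, .push r b s⟩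

theorem seq {a b : Cmd} {s s' s'' : Store} {T T' : ℕ} (h : Run a s s' T) (h' : Run b s' s'' T') :
    Run (.seq a b) s s'' (T + T') := by
  obtain ⟨t, ht, h⟩ := h
  obtain ⟨t', ht', h'⟩ := h'
  exact ⟨t + t', add_le_add ht ht', h.seq h'⟩

theorem branchTrue {r : Reg} {a b : Cmd} {s s' : Store} {l : List Bool} {T : ℕ}
    (hr : s.get r = true :: l) (h : Run a (s.set r l) s' T) :
    Run (.branch r a b) s s' (1 + T) := by
  obtain ⟨t, ht, h⟩ := h
  exact ⟨1 + t, by lia, .branchTrue hr h⟩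

theorem branchElse {r : Reg} {a b : Cmd} {s s' : Store} {T : ℕ}
    (hr : (s.get r).head? ≠ some true) (h : Run b (s.set r (s.get r).tail) s' T) :
    Run (.branch r a b) s s' (1 + T) := by
  obtain ⟨t, ht, h⟩ := h
  exact ⟨1 + t, by lia, .branchElse hr h⟩

theorem whileNext {r : Reg} {a : Cmd} {s s' s'' : Store} {l : List Bool} {T T' : ℕ}
    (hr : s.get r = true :: l) (h : Run a (s.set r l) s' T) (h' : Run (.whileTrue r a) s' s'' T') :
    Run (.whileTrue r a) s s'' (1 + T + T') := by
  obtain ⟨t, ht, h⟩ := h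
  obtain ⟨t', ht', h'⟩ := h'
  exact ⟨1 + t + t', by lia, .whileNext hr h h'⟩

theorem whileDone {r : Reg} {a : Cmd} {s : Store} (hr : (s.get r).head? ≠ some true) :
    Run (.whileTrue r a) s (s.set r (s.get r).tail) 1 := ⟨1, le_rfl, .whileDone hr⟩

theorem drainTrue {r : Reg} {a b : Cmd} {s s' s'' : Store} {l : List Bool} {T T' : ℕ}
    (hr : s.get r = true :: l) (h : Run a (s.set r l) s' T) (h' : Run (.drain r a b) s' s'' T') :
    Run (.drain r a b) s s'' (1 + T + T') := by
  obtain ⟨t, ht, h⟩ := h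
  obtain ⟨t', ht', h'⟩ := h'
  exact ⟨1 + t + t', by lia, .drainTrue hr h h'⟩

theorem drainFalse {r : Reg} {a b : Cmd} {s s' s'' : Store} {l : List Bool} {T T' : ℕ}
    (hr : s.get r = false :: l) (h : Run b (s.set r l) s' T) (h' : Run (.drain r a b) s' s'' T') :
    Run (.drain r a b) s s'' (1 + T + T') := by
  obtain ⟨t, ht, h⟩ := h
  obtain ⟨t', ht', h'⟩ := h'
  exact ⟨1 + t + t', by lia, .drainFalse hr h h'⟩

theorem drainDone {r : Reg} {a b : Cmd} {s : Store} (hr : s.get r = []) :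
    Run (.drain r a b) s (s.set r []) 1 := ⟨1, le_rfl, .drainDone hr⟩

/-- A loop that runs `k` times. -/
theorem whileIterate {r : Reg} {a : Cmd} {T : ℕ} {s s' : Store} (k : ℕ) (S : ℕ → Store)
    (h₀ : s = S 0)
    (hS : ∀ i < k, ∃ l, (S i).get r = true :: l ∧ Run a ((S i).set r l) (S (i + 1)) T)
    (hend : ((S k).get r).head? ≠ some true) (h₁ : (S k).set r ((S k).get r).tail = s') :
    Run (.whileTrue r a) s s' (k * (1 + T) + 1) := by
  subst h₀ h₁
  induction k generalizing S with
  | zero => simpa using whileDone hend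
  | succ k ih =>
    obtain ⟨l, hl, h⟩ := hS 0 (Nat.succ_pos k)
    refine (whileNext hl h
      (ih (fun i => S (i + 1)) (fun i hi => hS (i + 1) (by lia)) hend)).mono ?_
    rw [Nat.succ_mul]
    lia

end Run

notation:67 a ";;" b:66 => Cmd.seq a b

/-- The number `k` on a stack. -/
def ones (k : ℕ) : List Bool := List.replicate k true

@[simp] theorem ones_zero : ones 0 = [] := rfl

theorem ones_succ (k : ℕ) : ones (k + 1) = true :: ones k := rfl

theorem ones_pos {k : ℕ} (h : 0 < k) : ones k = true :: ones (k - 1) := by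
  obtain ⟨k, rfl⟩ := Nat.exists_eq_succ_of_ne_zero h.ne'
  rfl

@[simp] theorem ones_reverse (k : ℕ) : (ones k).reverse = ones k := List.reverse_replicate

theorem encodeUnary_eq (k : ℕ) : encodeUnary k = ones k ++ [false] := rfl

/-! ### Building blocks -/

/-- Write the given bits to the output. -/
def emit : List Bool → Cmd
  | [] => .skip
  | b :: l => .push .out b ;; emit l

theorem run_emit (l : List Bool) (s : Store) :
    Run (emit l) s { s with out := l.reverse ++ s.out } (l.length + 1) := by
  induction l generalizing s with
  | nil => exact Run.skip s
  | cons b l ih =>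
    refine ((Run.push .out b s).seq (ih _)).congr ?_ (by simp [add_comm])
    simp [Store.set, Store.get]

/-- Move a number to another stack. -/
def move (r r' : Reg) : Cmd := .whileTrue r (.push r' true)

theorem run_move {r r' : Reg} (hr : r ≠ r') (k : ℕ) (s : Store) (hs : s.get r = ones k) :
    Run (move r r') s ((s.set r []).set r' (ones k ++ s.get r')) (k * 2 + 1) := by
  refine Run.whileIterate (T := 1) k
    (fun i => (s.set r (ones (k - i))).set r' (ones i ++ s.get r')) ?_ ?_ ?_ ?_
  · rw [Nat.sub_zero, ← hs]
    cases r <;> cases r' <;> rfl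
  · intro i hi
    refine ⟨ones (k - i - 1), ?_, (Run.push r' true _).congr ?_ le_rfl⟩
    · rw [← ones_pos (by lia)]
      cases r <;> cases r' <;> first | rfl | exact absurd rfl hr
    · cases r <;> cases r' <;> first | rfl | exact absurd rfl hr
  · cases r <;> cases r' <;> first | exact absurd rfl hr | simp [Store.get, Store.set]
  · cases r <;> cases r' <;> first | exact absurd rfl hr | simp [Store.get, Store.set]

/-- Empty a stack that holds a number. -/
def clear (r : Reg) : Cmd := .whileTrue r .skip

theorem run_clear {r : Reg} (k : ℕ) (s : Store) (hs : s.get r = ones k) :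
    Run (clear r) s (s.set r []) (k * 2 + 1) := by
  refine Run.whileIterate (T := 1) k (fun i => s.set r (ones (k - i))) ?_ ?_ ?_ ?_
  · rw [Nat.sub_zero, ← hs]
    cases r <;> rfl
  · intro i hi
    refine ⟨ones (k - i - 1), ?_, (Run.skip _).congr ?_ le_rfl⟩
    · rw [← ones_pos (by lia)]
      cases r <;> rfl
    · cases r <;> rfl
  · cases r <;> simp [Store.get, Store.set]
  · cases r <;> simp [Store.get, Store.set]

/-- Write `l` as many times as the number on the stack `r` says. -/
def rep (r : Reg) (l : List Bool) : Cmd :=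
  .whileTrue r (.push .tmp true ;; emit l) ;; move .tmp r

theorem run_rep {r : Reg} (hr : r = .num ∨ r = .lft ∨ r = .rgt) (l : List Bool) {k : ℕ}
    {s : Store} (hs : s.get r = ones k) (ht : s.tmp = []) :
    Run (rep r l) s { s with out := (List.replicate k l).flatten.reverse ++ s.out }
      (k * (l.length + 5) + 2) := by
  have h₁ : Run (.whileTrue r (.push .tmp true ;; emit l)) s
      ({ s with
          out := (List.replicate k l).flatten.reverse ++ s.out
          tmp := ones k }.set r []) (k * (1 + (1 + (l.length + 1))) + 1) := by
    refine Run.whileIterate k (fun i => ({ s with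
        out := (List.replicate i l).flatten.reverse ++ s.out
        tmp := ones i }.set r (ones (k - i)))) ?_ ?_ ?_ ?_
    · rw [Nat.sub_zero, ← hs]
      cases s
      rcases hr with rfl | rfl | rfl <;> simp_all [Store.set, Store.get]
    · intro i hi
      refine ⟨ones (k - i - 1), ?_, ((Run.push .tmp true _).seq (run_emit l _)).congr ?_ le_rfl⟩
      · rw [← ones_pos (by lia)]
        rcases hr with rfl | rfl | rfl <;> rfl
      · rcases hr with rfl | rfl | rfl <;>
          simp [Store.set, Store.get, ones_succ, List.replicate_succ', Nat.sub_sub]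
    · rcases hr with rfl | rfl | rfl <;> simp [Store.set, Store.get]
    · rcases hr with rfl | rfl | rfl <;> simp [Store.set, Store.get]
  have hne : .tmp ≠ r := by rcases hr with rfl | rfl | rfl <;> simp
  refine (h₁.seq (run_move hne k _ ?_)).congr ?_ (by lia)
  · rcases hr with rfl | rfl | rfl <;> rfl
  · rcases hr with rfl | rfl | rfl <;> simp_all [Store.set, Store.get]

/-- Move the stack `aux` back to the input stack. -/
def rewind : Cmd := .drain .aux (.push .inp true) (.push .inp false)

theorem run_rewind (s : Store) (i a : List Bool) :
    Run rewind { s with inp := i, aux := a } { s with inp := a.reverse ++ i, aux := [] }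
      (a.length * 2 + 1) := by
  induction a generalizing i with
  | nil => exact Run.drainDone rfl
  | cons b a ih =>
    have h : Run rewind { s with inp := i, aux := b :: a }
        { s with inp := a.reverse ++ b :: i, aux := [] } (1 + 1 + (a.length * 2 + 1)) := by
      cases b
      · exact Run.drainFalse (s := { s with inp := i, aux := false :: a }) rfl
          (Run.push .inp false _) (ih (false :: i))
      · exact Run.drainTrue (s := { s with inp := i, aux := true :: a }) rfl
          (Run.push .inp true _) (ih (true :: i))
    refine h.congr (by simp) ?_
    simp only [List.length_cons]
    lia

/-! ### Scanning a formula -/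

/-- A formula as a list of tokens, the literals and the clause ends. -/
def tokens {n : ℕ} (cs : List (List (Fin n × Bool))) : List (Option (Fin n × Bool)) :=
  cs.flatMap fun C => C.map some ++ [none]

/-- The encoding of the list of clauses. -/
def encodeClauses {n : ℕ} (cs : List (List (Fin n × Bool))) : List Bool :=
  (cs.flatMap fun C => true :: CNF.encodeClause C) ++ [false]

/-- Read the formula on the input stack and move it to `aux`, running `lp` or `ln` on every literal
(these have to read the variable) and `fin` on every clause end. -/
def scan (lp ln fin : Cmd) : Cmd :=
  .whileTrue .inp
    (.push .aux true ;;
      .whileTrue .inp (.push .aux true ;;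
        .branch .inp (.push .aux true ;; lp) (.push .aux false ;; ln)) ;;
      .push .aux false ;; fin) ;;
  .push .aux false

/-- The loop invariant is left to the caller: `base p` is the store after the tokens `p` have been
processed, up to `inp` and `aux`, which the scan manages itself. What is read is pushed reversed on
`aux`, so that `rewind` can restore the formula for the next pass. The actions need to work only at
prefixes of the actual token list, so they may depend on the position. -/
theorem run_scan {n : ℕ} (cs : List (List (Fin n × Bool)))
    (base : List (Option (Fin n × Bool)) → Store) {lp ln fin : Cmd} {T : ℕ}
    (hlit : ∀ p (v : Fin n) b rest, p ++ some (v, b) :: rest = tokens cs → ∀ i a,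
      Run (cond b lp ln) { base p with inp := encodeUnary v ++ i, aux := a }
        { base (p ++ [some (v, b)]) with inp := i, aux := (encodeUnary v).reverse ++ a } T)
    (hfin : ∀ p rest, p ++ none :: rest = tokens cs → ∀ i a,
      Run fin { base p with inp := i, aux := a } { base (p ++ [none]) with inp := i, aux := a } T)
    (i a : List Bool) :
    Run (scan lp ln fin) { base [] with inp := encodeClauses cs ++ i, aux := a }
      { base (tokens cs) with inp := i, aux := (encodeClauses cs).reverse ++ a }
      ((tokens cs).length * (T + 4) + 2) := by
  have inner : ∀ (C : List (Fin n × Bool)) (p rest : List (Option (Fin n × Bool))),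
      p ++ C.map some ++ none :: rest = tokens cs → ∀ i a,
      Run (.whileTrue .inp (.push .aux true ;;
        .branch .inp (.push .aux true ;; lp) (.push .aux false ;; ln)))
        { base p with inp := CNF.encodeClause C ++ i, aux := a }
        { base (p ++ C.map some) with
          inp := i
          aux := (C.flatMap fun l => true :: l.2 :: encodeUnary l.1).reverse ++ a }
        (C.length * (T + 4) + 1) := by
    intro C
    induction C with
    | nil =>
      intro p rest _ i a
      refine (Run.whileDone (by simp [Store.get, CNF.encodeClause])).congr ?_ (by simp)
      simp [Store.get, Store.set, CNF.encodeClause]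
    | cons l C ih =>
      intro p rest hp i a
      obtain ⟨v, b⟩ := l
      have h₁ := hlit p v b (C.map some ++ none :: rest) (by simpa using hp)
        (CNF.encodeClause C ++ i) (b :: true :: a)
      have h₂ := ih (p ++ [some (v, b)]) rest (by simpa using hp) i
        ((encodeUnary v).reverse ++ b :: true :: a)
      have hin : CNF.encodeClause ((v, b) :: C) ++ i
          = true :: b :: (encodeUnary v ++ (CNF.encodeClause C ++ i)) := by
        simp [CNF.encodeClause]
      rw [hin]
      have h₃ : Run (.push .aux true ;;
          .branch .inp (.push .aux true ;; lp) (.push .aux false ;; ln))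
          { base p with inp := b :: (encodeUnary v ++ (CNF.encodeClause C ++ i)), aux := a }
          { base (p ++ [some (v, b)]) with
            inp := CNF.encodeClause C ++ i
            aux := (encodeUnary v).reverse ++ b :: true :: a } (1 + (1 + (1 + T))) := by
        cases b
        · exact (Run.push .aux true _).seq (Run.branchElse (by simp [Store.get, Store.set])
            ((Run.push .aux false _).seq h₁))
        · exact (Run.push .aux true _).seq (Run.branchTrue rfl ((Run.push .aux true _).seq h₁))
      refine (Run.whileNext rfl h₃ h₂).congr ?_ ?_
      · simp
      · simp only [List.length_cons, Nat.succ_mul]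
        lia
  have outer : ∀ (ds : List (List (Fin n × Bool))) (p : List (Option (Fin n × Bool))),
      p ++ tokens ds = tokens cs → ∀ a,
      Run (.whileTrue .inp
        (.push .aux true ;;
          .whileTrue .inp (.push .aux true ;;
            .branch .inp (.push .aux true ;; lp) (.push .aux false ;; ln)) ;;
          .push .aux false ;; fin))
        { base p with inp := encodeClauses ds ++ i, aux := a }
        { base (p ++ tokens ds) with
          inp := i
          aux := (ds.flatMap fun C => true :: CNF.encodeClause C).reverse ++ a }
        ((tokens ds).length * (T + 4) + 1) := by
    intro ds
    induction ds with
    | nil =>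
      intro p _ a
      refine (Run.whileDone (by simp [Store.get, encodeClauses])).congr ?_ (by simp)
      simp [Store.get, Store.set, encodeClauses, tokens]
    | cons C ds ih =>
      intro p hp a
      have hp' : p ++ C.map some ++ none :: tokens ds = tokens cs := by
        rw [← hp]
        simp [tokens]
      have h₁ := inner C p (tokens ds) hp' (encodeClauses ds ++ i) (true :: a)
      have h₂ := hfin (p ++ C.map some) (tokens ds) hp' (encodeClauses ds ++ i)
        (false :: ((C.flatMap fun l => true :: l.2 :: encodeUnary l.1).reverse ++ true :: a))
      have h₃ := ih (p ++ C.map some ++ [none]) (by simpa using hp')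
        (false :: ((C.flatMap fun l => true :: l.2 :: encodeUnary l.1).reverse ++ true :: a))
      have hin : encodeClauses (C :: ds) ++ i
          = true :: (CNF.encodeClause C ++ (encodeClauses ds ++ i)) := by
        simp [encodeClauses]
      rw [hin]
      refine (Run.whileNext rfl ((Run.push .aux true _).seq (h₁.seq
        ((Run.push .aux false _).seq h₂))) h₃).congr ?_ ?_
      · simp [tokens, CNF.encodeClause]
      · simp only [tokens, List.flatMap_cons, List.length_append, List.length_map,
          List.length_cons, List.length_nil, Nat.add_mul]
        lia
  refine ((outer cs [] rfl a).seq (Run.push .aux false _)).congr ?_ (by lia)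
  simp [Store.set, Store.get, encodeClauses]

end StackProg

namespace StackProg

/-! ### The program of the reduction -/

/-- Four zeros. -/
def zeros : List Bool := [false, false, false, false]

/-- The marks of the pair of vertices that stands for a literal of the given sign. -/
def pairBits (b : Bool) : List Bool := [b, true, !b, false]

/-- Move a variable from the input stack to `aux`. -/
def skipVar : Cmd := .whileTrue .inp (.push .aux true) ;; .push .aux false

theorem run_skipVar (s : Store) (k : ℕ) (i a : List Bool) :
    Run skipVar { s with inp := encodeUnary k ++ i, aux := a }
      { s with inp := i, aux := (encodeUnary k).reverse ++ a } (k * 2 + 2) := by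
  have h : Run (.whileTrue .inp (.push .aux true)) { s with inp := encodeUnary k ++ i, aux := a }
      { s with inp := i, aux := ones k ++ a } (k * (1 + 1) + 1) := by
    refine Run.whileIterate k
      (fun j => { s with inp := encodeUnary (k - j) ++ i, aux := ones j ++ a }) ?_ ?_ ?_ ?_
    · simp
    · intro j hj
      refine ⟨encodeUnary (k - j - 1) ++ i, ?_, (Run.push .aux true _).congr ?_ le_rfl⟩
      · simp [Store.get, encodeUnary_eq, ones_pos (show 0 < k - j by lia)]
      · rfl
    · simp [Store.get, encodeUnary_eq]
    · simp [Store.get, Store.set, encodeUnary_eq]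
  refine (h.seq (Run.push .aux false _)).congr ?_ (by lia)
  simp [Store.get, Store.set, encodeUnary_eq]

/-- Move a variable from the input stack to `aux`, and copy it to `var`. -/
def copyVar : Cmd := .whileTrue .inp (.push .aux true ;; .push .var true) ;; .push .aux false

theorem run_copyVar (s : Store) (hs : s.var = []) (k : ℕ) (i a : List Bool) :
    Run copyVar { s with inp := encodeUnary k ++ i, aux := a }
      { s with inp := i, aux := (encodeUnary k).reverse ++ a, var := ones k } (k * 3 + 2) := by
  have h : Run (.whileTrue .inp (.push .aux true ;; .push .var true))
      { s with inp := encodeUnary k ++ i, aux := a }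
      { s with inp := i, aux := ones k ++ a, var := ones k } (k * (1 + (1 + 1)) + 1) := by
    refine Run.whileIterate k
      (fun j => { s with inp := encodeUnary (k - j) ++ i, aux := ones j ++ a, var := ones j })
      ?_ ?_ ?_ ?_
    · simp [hs]
    · intro j hj
      refine ⟨encodeUnary (k - j - 1) ++ i, ?_,
        ((Run.push .aux true _).seq (Run.push .var true _)).congr ?_ le_rfl⟩
      · simp [Store.get, encodeUnary_eq, ones_pos (show 0 < k - j by lia)]
      · rfl
    · simp [Store.get, encodeUnary_eq]
    · simp [Store.get, Store.set, encodeUnary_eq]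
  refine (h.seq (Run.push .aux false _)).congr ?_ (by lia)
  simp [Store.get, Store.set, encodeUnary_eq]

/-- Read a variable and write the marks of its literal if it is the one on the stack `var`, and
zeros otherwise. -/
def cmpVar (b : Bool) : Cmd :=
  .whileTrue .inp (.push .aux true ;; .branch .var (.push .sav true) (.push .exc true)) ;;
  .push .aux false ;;
  .branch .var (.push .var true ;; emit zeros) (.branch .exc (emit zeros) (emit (pairBits b))) ;;
  clear .exc ;; move .sav .var

/-- Each mark of the variable `k` that is read consumes a mark of `var`: matched marks are kept on
`sav`, surplus ones are counted on `exc`. Afterwards `k = v` exactly when both `var` and `exc` are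
empty, and `sav` restores `var`. -/
theorem run_cmpVar (b : Bool) (s : Store) (v k : ℕ) (hv : s.var = ones v) (hsav : s.sav = [])
    (hexc : s.exc = []) (i a o : List Bool) :
    Run (cmpVar b) { s with inp := encodeUnary k ++ i, aux := a, out := o }
      { s with
        inp := i
        aux := (encodeUnary k).reverse ++ a
        out := (if k = v then pairBits b else zeros).reverse ++ o } (k * 8 + 14) := by
  have h₁ : Run (.whileTrue .inp
      (.push .aux true ;; .branch .var (.push .sav true) (.push .exc true)))
      { s with inp := encodeUnary k ++ i, aux := a, out := o }
      { s with
        inp := i, aux := ones k ++ a, out := o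
        var := ones (v - k), sav := ones (min k v), exc := ones (k - v) }
      (k * (1 + (1 + (1 + 1))) + 1) := by
    refine Run.whileIterate k (fun j => { s with
        inp := encodeUnary (k - j) ++ i, aux := ones j ++ a, out := o
        var := ones (v - j), sav := ones (min j v), exc := ones (j - v) }) ?_ ?_ ?_ ?_
    · simp [hv, hsav, hexc]
    · intro j hj
      refine ⟨encodeUnary (k - j - 1) ++ i, ?_, ?_⟩
      · simp [Store.get, encodeUnary_eq, ones_pos (show 0 < k - j by lia)]
      · refine (Run.push .aux true _).seq ?_
        by_cases hjv : j < v
        · refine (Run.branchTrue (l := ones (v - j - 1)) ?_ (Run.push .sav true _)).congr ?_ le_rfl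
          · simp [Store.get, Store.set, ones_pos (show 0 < v - j by lia)]
          · have e₁ : min (j + 1) v = min j v + 1 := by lia
            have e₂ : j + 1 - v = j - v := by lia
            simp [Store.get, Store.set, e₁, e₂, ones_succ, Nat.sub_sub]
        · have e₀ : v - j = 0 := by lia
          refine (Run.branchElse ?_ (Run.push .exc true _)).congr ?_ le_rfl
          · simp [Store.get, Store.set, e₀]
          · have e₁ : min (j + 1) v = min j v := by lia
            have e₂ : j + 1 - v = j - v + 1 := by lia
            have e₃ : v - (j + 1) = 0 := by lia
            simp [Store.get, Store.set, e₀, e₁, e₂, e₃, ones_succ, Nat.sub_sub]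
    · simp [Store.get, encodeUnary_eq]
    · simp [Store.get, Store.set, encodeUnary_eq]
  -- Testing a stack pops a symbol. For `var` it is pushed back; `exc` is cleared anyway, so only a
  -- bound on the remaining number `e` is kept.
  have h₂ : ∃ e ≤ k, Run
      (.branch .var (.push .var true ;; emit zeros) (.branch .exc (emit zeros) (emit (pairBits b))))
      { s with
        inp := i, aux := false :: (ones k ++ a), out := o
        var := ones (v - k), sav := ones (min k v), exc := ones (k - v) }
      { s with
        inp := i, aux := false :: (ones k ++ a)
        out := (if k = v then pairBits b else zeros).reverse ++ o
        var := ones (v - k), sav := ones (min k v), exc := ones e } 7 := by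
    by_cases hkv : k < v
    · refine ⟨k - v, by lia, (Run.branchTrue (l := ones (v - k - 1)) ?_
        ((Run.push .var true _).seq (run_emit zeros _))).congr ?_ (by simp [zeros])⟩
      · simp [Store.get, ones_pos (show 0 < v - k by lia)]
      · simp [Store.get, Store.set, hkv.ne, ← ones_pos (show 0 < v - k by lia)]
    · have e₀ : v - k = 0 := by lia
      by_cases hvk : v < k
      · refine ⟨k - v - 1, by lia, (Run.branchElse (by simp [Store.get, e₀])
          (Run.branchTrue (l := ones (k - v - 1)) ?_ (run_emit zeros _))).congr ?_
            (by simp [zeros])⟩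
        · simp [Store.get, Store.set, ones_pos (show 0 < k - v by lia)]
        · simp [Store.get, Store.set, hvk.ne', e₀]
      · have e₁ : k = v := by lia
        subst e₁
        refine ⟨0, by lia, (Run.branchElse (by simp [Store.get])
          (Run.branchElse (by simp [Store.get, Store.set]) (run_emit (pairBits b) _))).congr ?_
            (by simp [pairBits])⟩
        simp [Store.get, Store.set]
  obtain ⟨e, he, h₂⟩ := h₂
  refine (h₁.seq ((Run.push .aux false _).seq (h₂.seq ((run_clear e _ rfl).seq
    (run_move (by simp) (min k v) _ rfl))))).congr ?_ (by lia)
  have e₁ : ones (min k v) ++ ones (v - k) = ones v := by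
    rw [ones, ones, ones, ← List.replicate_add]
    congr 1
    lia
  simp [Store.get, Store.set, encodeUnary_eq, hexc, hsav, e₁, hv]

/-- Write the row of zeros and a one that marks the variable on the stack `var`. -/
def oneHot : Cmd :=
  .whileTrue .var (.push .sav true ;; .branch .num (.push .tmp true) .skip ;; emit [false]) ;;
  emit [true] ;; .branch .num (.push .tmp true) .skip ;;
  .whileTrue .num (.push .tmp true ;; emit [false]) ;; move .sav .var ;; move .tmp .num

theorem run_oneHot (s : Store) (v n : ℕ) (hvn : v < n) (hv : s.var = ones v)
    (hn : s.num = ones n) (hsav : s.sav = []) (htmp : s.tmp = []) :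
    Run oneHot s { s with
        out := (List.replicate v false ++ true :: List.replicate (n - v - 1) false).reverse
          ++ s.out } (n * 14 + 10) := by
  have h₁ : Run (.whileTrue .var (.push .sav true ;;
      .branch .num (.push .tmp true) .skip ;; emit [false])) s
      { s with
        var := [], sav := ones v, num := ones (n - v), tmp := ones v
        out := List.replicate v false ++ s.out } (v * (1 + (1 + ((1 + 1) + 2))) + 1) := by
    refine Run.whileIterate v (fun j => { s with
        var := ones (v - j), sav := ones j, num := ones (n - j), tmp := ones j
        out := List.replicate j false ++ s.out }) ?_ ?_ ?_ ?_
    · cases s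
      simp_all
    · intro j hj
      refine ⟨ones (v - j - 1), ones_pos (show 0 < v - j by lia), ?_⟩
      refine ((Run.push .sav true _).seq ((Run.branchTrue (l := ones (n - j - 1)) ?_
        (Run.push .tmp true _)).seq (run_emit [false] _))).congr ?_ le_rfl
      · exact ones_pos (show 0 < n - j by lia)
      · simp [Store.get, Store.set, ones_succ, List.replicate_succ, Nat.sub_sub]
    · simp [Store.get]
    · simp [Store.get, Store.set]
  have h₂ : Run (.whileTrue .num (.push .tmp true ;; emit [false]))
      { s with
        var := [], sav := ones v, num := ones (n - v - 1), tmp := ones (v + 1)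
        out := true :: (List.replicate v false ++ s.out) }
      { s with
        var := [], sav := ones v, num := [], tmp := ones n
        out := List.replicate (n - v - 1) false ++ true :: (List.replicate v false ++ s.out) }
      ((n - v - 1) * (1 + (1 + 2)) + 1) := by
    refine Run.whileIterate (n - v - 1) (fun j => { s with
        var := [], sav := ones v, num := ones (n - v - 1 - j), tmp := ones (v + 1 + j)
        out := List.replicate j false ++ true :: (List.replicate v false ++ s.out) }) ?_ ?_ ?_ ?_
    · simp
    · intro j hj
      refine ⟨ones (n - v - 1 - j - 1), ones_pos (show 0 < n - v - 1 - j by lia), ?_⟩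
      refine ((Run.push .tmp true _).seq (run_emit [false] _)).congr ?_ le_rfl
      simp [Store.get, Store.set, ones_succ, List.replicate_succ, Nat.sub_sub, ← add_assoc]
    · simp [Store.get]
    · have : v + 1 + (n - v - 1) = n := by lia
      simp [Store.get, Store.set, this]
  refine (h₁.seq ((run_emit [true] _).seq ((Run.branchTrue (l := ones (n - v - 1)) ?_
    (Run.push .tmp true _)).seq (h₂.seq ((run_move (by simp) v _ rfl).seq
      (run_move (by simp) n _ rfl)))))).congr ?_ ?_
  · exact ones_pos (show 0 < n - v by lia)
  · simp [Store.get, Store.set, hv, hn, hsav, htmp]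
  · simp only [List.length_cons, List.length_nil]
    lia

/-- Write marks for all tokens of the formula. -/
theorem run_scan_emit {n : ℕ} (cs : List (List (Fin n × Bool)))
    (f : Option (Fin n × Bool) → List Bool) (s : Store) {lp ln fin : Cmd} {T : ℕ}
    (hlit : ∀ (v : Fin n) b i a o,
      Run (cond b lp ln) { s with inp := encodeUnary v ++ i, aux := a, out := o }
        { s with
          inp := i
          aux := (encodeUnary v).reverse ++ a
          out := (f (some (v, b))).reverse ++ o } T)
    (hfin : ∀ i a o, Run fin { s with inp := i, aux := a, out := o }
      { s with inp := i, aux := a, out := (f none).reverse ++ o } T)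
    (hinp : s.inp = encodeClauses cs) (haux : s.aux = []) :
    Run (scan lp ln fin ;; rewind) s
      { s with out := ((tokens cs).flatMap f).reverse ++ s.out }
      ((tokens cs).length * (T + 4) + 3 + (encodeClauses cs).length * 2) := by
  have h₁ := run_scan cs (fun p => { s with out := (p.flatMap f).reverse ++ s.out })
    (lp := lp) (ln := ln) (fin := fin) (T := T)
    (fun p v b rest _ i a => (hlit v b i a _).congr (by simp) le_rfl)
    (fun p rest _ i a => (hfin i a _).congr (by simp) le_rfl) [] []
  have h₂ := h₁.seq (run_rewind _ _ _)
  obtain ⟨⟩ := s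
  simp only at hinp haux
  subst hinp haux
  simp only [List.append_nil, List.flatMap_nil, List.reverse_nil, List.nil_append,
    List.reverse_reverse, List.length_reverse] at h₂ ⊢
  refine h₂.mono ?_
  lia

end StackProg

/-! ### Writing the encoded graph, row by row -/

namespace StackProg

/-- Read the number of variables. -/
def readNum : Cmd := .whileTrue .inp (.push .num true ;; .push .row true)

theorem run_readNum (n : ℕ) (i : List Bool) :
    Run readNum (.ofInput (encodeUnary n ++ i))
      ⟨i, [], [], ones n, ones n, [], [], [], [], [], []⟩ (n * (1 + (1 + 1)) + 1) := by
  refine Run.whileIterate n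
    (fun j => ⟨encodeUnary (n - j) ++ i, [], [], ones j, ones j, [], [], [], [], [], []⟩)
    ?_ ?_ ?_ ?_
  · rfl
  · intro j hj
    refine ⟨encodeUnary (n - j - 1) ++ i, ?_,
      ((Run.push .num true _).seq (Run.push .row true _)).congr ?_ le_rfl⟩
    · simp [Store.get, encodeUnary_eq, ones_pos (show 0 < n - j by lia)]
    · rfl
  · simp [Store.get, encodeUnary_eq]
  · simp [Store.get, Store.set, encodeUnary_eq]

/-- Count the tokens. -/
def countTokens : Cmd :=
  scan (skipVar ;; .push .rgt true) (skipVar ;; .push .rgt true) (.push .rgt true) ;; rewind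

theorem run_countTokens {n : ℕ} (cs : List (List (Fin n × Bool))) (s : Store)
    (hinp : s.inp = encodeClauses cs) (haux : s.aux = []) (hrgt : s.rgt = []) :
    Run countTokens s { s with rgt := ones (tokens cs).length }
      ((tokens cs).length * (n * 2 + 7) + 3 + (encodeClauses cs).length * 2) := by
  have h₁ := run_scan cs (fun p => { s with rgt := ones p.length })
    (lp := skipVar ;; .push .rgt true) (ln := skipVar ;; .push .rgt true)
    (fin := .push .rgt true) (T := n * 2 + 3)
    (fun p v b rest _ i a => by
      rw [Bool.cond_self]
      refine ((run_skipVar _ v i a).seq (Run.push .rgt true _)).congr ?_ ?_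
      · simp [Store.get, Store.set, ones_succ]
      · have := v.2
        lia)
    (fun p rest _ i a => (Run.push .rgt true _).congr
      (by simp [Store.get, Store.set, ones_succ]) (by lia)) [] []
  have h₂ := h₁.seq (run_rewind _ _ _)
  obtain ⟨⟩ := s
  simp only at hinp haux hrgt
  subst hinp haux hrgt
  simp only [List.append_nil, List.length_nil, ones_zero, List.reverse_reverse,
    List.length_reverse] at h₂ ⊢
  exact h₂.mono (by lia)

/-- Write the parameter, if it is asked for, and the number of vertices, in unary. -/
def header (given : Bool) : Cmd :=
  cond given (rep .num [true] ;; emit [true, true, true, true, true, false]) .skip ;;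
  rep .num [true] ;; emit [true, true, true, true, true, true, true] ;;
  rep .rgt [true, true, true, true] ;; emit [false]

theorem flatten_replicate_replicate {α : Type*} (k j : ℕ) (b : α) :
    (List.replicate k (List.replicate j b)).flatten = List.replicate (k * j) b := by
  simp

/-- Here `n + 5` is the bound on both parameters that serves as the given `t`, and `n + 7 + 4 * m`
is the number of vertices: `n` variables, `P`, `Q`, `T`, `F`, `R`, `S`, `z` and four for each of `m`
tokens. -/
theorem run_header (given : Bool) (s : Store) (n m : ℕ) (hn : s.num = ones n)
    (hm : s.rgt = ones m) (ht : s.tmp = []) :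
    Run (header given) s { s with
        out := (cond given (encodeUnary (n + 5)) [] ++ encodeUnary (n + 7 + 4 * m)).reverse
          ++ s.out } (n * 12 + m * 9 + 30) := by
  have h₁ : Run (cond given (rep .num [true] ;; emit [true, true, true, true, true, false]) .skip) s
      { s with out := (cond given (encodeUnary (n + 5)) []).reverse ++ s.out } (n * 6 + 9) := by
    cases given
    · exact (Run.skip s).mono (by lia)
    · refine ((run_rep (.inl rfl) [true] (by exact hn) (by exact ht)).seq
        (run_emit [true, true, true, true, true, false] _)).congr ?_ (by simp)
      simp [encodeUnary, List.replicate_add]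
  refine (h₁.seq ((run_rep (.inl rfl) [true] (k := n) (by exact hn) (by exact ht)).seq
    ((run_emit [true, true, true, true, true, true, true] _).seq
    ((run_rep (.inr (.inr rfl)) [true, true, true, true] (k := m) (by exact hm) (by exact ht)).seq
      (run_emit [false] _))))).congr ?_ (by simp; lia)
  have : (List.replicate m [true, true, true, true]).flatten = List.replicate (4 * m) true := by
    rw [mul_comm]
    exact flatten_replicate_replicate m 4 true
  simp [encodeUnary, List.replicate_add, this]

/-- The marks of the block of a token in the row of the variable `v`. -/
def varBits {n : ℕ} (v : ℕ) : Option (Fin n × Bool) → List Bool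
  | none => zeros
  | some (i, b) => if (i : ℕ) = v then pairBits b else zeros

/-- The row of a variable. -/
def varRowBits {n : ℕ} (toks : List (Option (Fin n × Bool))) (v : ℕ) : List Bool :=
  List.replicate n false ++ [true, true, false, false, false, false] ++
    toks.flatMap (varBits v) ++ [false]

/-- Write the row of the variable on the stack `var`. -/
def varRow : Cmd :=
  rep .num [false] ;; emit [true, true, false, false, false, false] ;;
  (scan (cmpVar true) (cmpVar false) (emit zeros) ;; rewind) ;; emit [false]

theorem run_varRow {n : ℕ} (cs : List (List (Fin n × Bool))) (v : ℕ) (s : Store)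
    (hinp : s.inp = encodeClauses cs) (haux : s.aux = []) (hnum : s.num = ones n)
    (hvar : s.var = ones v) (hsav : s.sav = []) (hexc : s.exc = []) (htmp : s.tmp = []) :
    Run varRow s { s with out := (varRowBits (tokens cs) v).reverse ++ s.out }
      (n * 6 + 14 + (tokens cs).length * (n * 8 + 18) + (encodeClauses cs).length * 2) := by
  have h := fun s₀ : Store => fun hs₀ : s₀.var = ones v => fun hsav₀ : s₀.sav = [] =>
    fun hexc₀ : s₀.exc = [] => run_scan_emit cs (varBits v) s₀ (lp := cmpVar true)
      (ln := cmpVar false) (fin := emit zeros) (T := n * 8 + 14)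
      (fun w b i a o => by
        have := (run_cmpVar b s₀ v w hs₀ hsav₀ hexc₀ i a o).mono (T' := n * 8 + 14)
          (by have := w.2; lia)
        cases b <;> exact this)
      (fun i a o => (run_emit zeros _).mono (by simp [zeros]))
  refine ((run_rep (.inl rfl) [false] (k := n) (by exact hnum) (by exact htmp)).seq
    ((run_emit [true, true, false, false, false, false] _).seq
    ((h _ (by exact hvar) (by exact hsav) (by exact hexc) (by exact hinp) (by exact haux)).seq
    (run_emit [false] _)))).congr ?_ (by simp; lia)
  simp [varRowBits]

/-- Write the rows of all variables. -/
def varRows : Cmd := .whileTrue .row (varRow ;; .push .var true) ;; clear .var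

theorem run_varRows {n : ℕ} (cs : List (List (Fin n × Bool))) (s : Store)
    (hinp : s.inp = encodeClauses cs) (haux : s.aux = []) (hnum : s.num = ones n)
    (hvar : s.var = []) (hsav : s.sav = []) (hexc : s.exc = []) (htmp : s.tmp = [])
    (hrow : s.row = ones n) :
    Run varRows s
      { s with
        out := ((List.range n).flatMap (varRowBits (tokens cs))).reverse ++ s.out
        row := [] }
      (n * (n * 6 + 18 + (tokens cs).length * (n * 8 + 18) + (encodeClauses cs).length * 2)
        + 2) := by
  have h₁ : Run (.whileTrue .row (varRow ;; .push .var true)) s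
      { s with
        out := ((List.range n).flatMap (varRowBits (tokens cs))).reverse ++ s.out
        row := []
        var := ones n }
      (n * (1 + ((n * 6 + 14 + (tokens cs).length * (n * 8 + 18) + (encodeClauses cs).length * 2)
        + 1)) + 1) := by
    refine Run.whileIterate n (fun j => { s with
        out := ((List.range j).flatMap (varRowBits (tokens cs))).reverse ++ s.out
        row := ones (n - j)
        var := ones j }) ?_ ?_ ?_ ?_
    · cases s
      simp_all
    · intro j hj
      refine ⟨ones (n - j - 1), ones_pos (show 0 < n - j by lia), ?_⟩
      refine ((run_varRow cs j _ (by exact hinp) (by exact haux) (by exact hnum) (by rfl)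
        (by exact hsav) (by exact hexc) (by exact htmp)).seq
        (Run.push .var true _)).congr ?_ le_rfl
      simp [Store.get, Store.set, ones_succ, List.range_succ, Nat.sub_sub]
    · simp [Store.get]
    · simp [Store.get, Store.set]
  refine (h₁.seq (run_clear n _ rfl)).congr (by simp [Store.set, hvar]) ?_
  simp only [Nat.mul_add]
  lia

/-- Write a row without marks in the blocks. -/
def plainRow (b : Bool) (l l' : List Bool) : Cmd :=
  rep .num [b] ;; emit l ;; rep .rgt zeros ;; emit l'

theorem run_plainRow (b : Bool) (l l' : List Bool) (s : Store) (n m : ℕ) (hn : s.num = ones n)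
    (hm : s.rgt = ones m) (ht : s.tmp = []) :
    Run (plainRow b l l') s { s with
        out := (List.replicate n b ++ l ++ (List.replicate m zeros).flatten ++ l').reverse ++ s.out }
      (n * 6 + m * 9 + l.length + l'.length + 6) := by
  refine ((run_rep (.inl rfl) [b] (k := n) (by exact hn) (by exact ht)).seq ((run_emit l _).seq
    ((run_rep (.inr (.inr rfl)) zeros (k := m) (by exact hm) (by exact ht)).seq
    (run_emit l' _)))).congr ?_ ?_
  · simp
  · simp [zeros]
    lia

/-- Write a row whose marks in the blocks depend only on the kind of token. -/
def kindRow (l : List Bool) (f : Option Bool → List Bool) : Cmd :=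
  rep .num [false] ;; emit l ;;
  (scan (skipVar ;; emit (f (some true))) (skipVar ;; emit (f (some false))) (emit (f none)) ;;
    rewind) ;; emit [false]

theorem run_kindRow {n : ℕ} (cs : List (List (Fin n × Bool))) (l : List Bool)
    (f : Option Bool → List Bool) (hf : ∀ x, (f x).length ≤ 4) (s : Store)
    (hinp : s.inp = encodeClauses cs) (haux : s.aux = []) (hnum : s.num = ones n)
    (htmp : s.tmp = []) :
    Run (kindRow l f) s { s with
        out := (List.replicate n false ++ l ++
          (tokens cs).flatMap (fun t => f (t.map Prod.snd)) ++ [false]).reverse ++ s.out }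
      (n * 6 + l.length + 10 + (tokens cs).length * (n * 2 + 11)
        + (encodeClauses cs).length * 2) := by
  have h := fun s₀ : Store => run_scan_emit cs (fun t => f (t.map Prod.snd)) s₀
      (lp := skipVar ;; emit (f (some true)))
      (ln := skipVar ;; emit (f (some false))) (fin := emit (f none)) (T := n * 2 + 7)
      (fun w b i a o => by
        have hw := w.2
        have := hf (some b)
        cases b <;>
        · refine ((run_skipVar { s₀ with out := o } w i a).seq (run_emit _ _)).mono ?_
          lia)
      (fun i a o => (run_emit _ _).mono (by have := hf none; lia))
  refine ((run_rep (.inl rfl) [false] (k := n) (by exact hnum) (by exact htmp)).seq ((run_emit l _).seq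
    ((h _ (by exact hinp) (by exact haux)).seq (run_emit [false] _)))).congr ?_ (by simp; lia)
  simp

/-- The row of zeros and a one at position `v`. -/
def hot (n v : ℕ) : List Bool := List.replicate v false ++ true :: List.replicate (n - v - 1) false

/-- For the four rows of a block: whether they mark the variable, the marks of the fixed vertices
and the marks of the block and its two neighbors. -/
def blockTable : Option Bool → List (Bool × List Bool × List Bool)
  | some b =>
    [(b, [false, false, b, false, false], [true, false, true, false, false, false]),
      (true, [false, false, b, !b, false], [false, true, false, true, false, false]),
      (!b, [false, false, false, !b, false], [false, false, true, false, true, false]),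
      (false, [false, false, false, false, false], [false, false, false, true, false, true])]
  | none =>
    [(false, [false, false, false, false, false], [true, false, true, false, false, false]),
      (false, [false, false, true, false, false], [false, true, false, false, false, false]),
      (false, [false, false, false, false, false], [false, false, false, false, true, false]),
      (false, [false, false, false, true, false], [false, false, false, true, false, true])]

/-- A row of a block with `l` blocks to the left and `r` blocks to the right. -/
def blockRowBits (n v l r : ℕ) (x : Bool × List Bool × List Bool) : List Bool :=
  (if x.1 then hot n v else List.replicate n false) ++ x.2.1 ++
    (List.replicate l zeros).flatten ++ x.2.2 ++ (List.replicate r zeros).flatten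

/-- Write the rows of a block. -/
def blockRows : List (Bool × List Bool × List Bool) → Cmd
  | [] => .skip
  | x :: xs => cond x.1 oneHot (rep .num [false]) ;; emit x.2.1 ;; rep .lft zeros ;;
      emit x.2.2 ;; rep .rgt zeros ;; blockRows xs

theorem run_blockRows (n v l r : ℕ) (xs : List (Bool × List Bool × List Bool))
    (hlen : ∀ x ∈ xs, x.2.1.length ≤ 5 ∧ x.2.2.length ≤ 6) (s : Store)
    (hvar : ∀ x ∈ xs, x.1 = true → s.var = ones v ∧ v < n) (hnum : s.num = ones n)
    (hsav : s.sav = []) (htmp : s.tmp = []) (hl : s.lft = ones l) (hr : s.rgt = ones r) :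
    Run (blockRows xs) s { s with
        out := (xs.flatMap (blockRowBits n v l r)).reverse ++ s.out }
      (xs.length * (n * 14 + l * 9 + r * 9 + 30) + 1) := by
  induction xs generalizing s with
  | nil => exact (Run.skip s).congr (by simp) (by simp)
  | cons x xs ih =>
    have h₁ : Run (cond x.1 oneHot (rep .num [false])) s { s with
        out := (if x.1 then hot n v else List.replicate n false).reverse ++ s.out }
        (n * 14 + 10) := by
      cases hx : x.1
      · exact (run_rep (.inl rfl) [false] (k := n) (by exact hnum) (by exact htmp)).congr
          (by simp) (by simp; lia)
      · obtain ⟨h, h'⟩ := hvar x (by simp) hx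
        exact run_oneHot s v n h' h hnum hsav htmp
    refine (h₁.seq ((run_emit x.2.1 _).seq ((run_rep (.inr (.inl rfl)) zeros (k := l)
      (by exact hl) (by exact htmp)).seq ((run_emit x.2.2 _).seq
        ((run_rep (.inr (.inr rfl)) zeros (k := r) (by exact hr) (by exact htmp)).seq
          (ih (fun y hy => hlen y (by simp [hy])) _ (fun y hy => hvar y (by simp [hy]))
            (by exact hnum) (by exact hsav) (by exact htmp) (by exact hl) (by exact hr))))))).congr
        ?_ ?_
    · simp [blockRowBits]
    · have := hlen x (by simp)
      simp only [zeros, List.length_cons, List.length_nil, Nat.succ_mul]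
      lia

/-- Write the rows of the block of a literal, or of a clause end. -/
def block : Option Bool → Cmd
  | some b => copyVar ;; .branch .rgt .skip .skip ;; blockRows (blockTable (some b)) ;;
      clear .var ;; .push .lft true
  | none => .branch .rgt .skip .skip ;; blockRows (blockTable none) ;; .push .lft true

/-- The rows of the block of a token with `l` blocks to the left and `r` blocks to the right. -/
def blockBits {n : ℕ} (l r : ℕ) (t : Option (Fin n × Bool)) : List Bool :=
  (blockTable (t.map Prod.snd)).flatMap (blockRowBits n (t.elim 0 fun x => x.1) l r)

theorem blockTable_length (x : Option Bool) :
    ∀ y ∈ blockTable x, y.2.1.length ≤ 5 ∧ y.2.2.length ≤ 6 := by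
  rcases x with _ | _ | _ <;> simp [blockTable]

theorem length_blockTable (x : Option Bool) : (blockTable x).length = 4 := by
  cases x <;> rfl

theorem run_block {n : ℕ} (t : Option (Fin n × Bool)) (l r : ℕ) (s : Store)
    (hnum : s.num = ones n) (hvar : s.var = []) (hsav : s.sav = []) (htmp : s.tmp = [])
    (hl : s.lft = ones l) (hr : s.rgt = ones (r + 1)) (i a : List Bool) :
    Run (block (t.map Prod.snd))
      { s with inp := t.elim [] (fun x => encodeUnary x.1) ++ i, aux := a }
      { s with
        inp := i
        aux := t.elim [] (fun x => (encodeUnary x.1).reverse) ++ a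
        out := (blockBits l r t).reverse ++ s.out
        lft := ones (l + 1)
        rgt := ones r } (n * 61 + l * 36 + r * 36 + 130) := by
  -- The branch only pops: before the block `rgt` still counts the current token, while the rows
  -- need the number of blocks strictly to the right.
  have h₁ : ∀ s₀ : Store, s₀.rgt = ones (r + 1) →
      Run (.branch .rgt .skip .skip) s₀ { s₀ with rgt := ones r } (1 + 1) :=
    fun s₀ h => Run.branchTrue h (Run.skip _)
  rcases t with _ | ⟨v, b⟩
  · refine ((h₁ _ (by exact hr)).seq ((run_blockRows n 0 l r (blockTable none)
      (blockTable_length _) _ (by simp [blockTable]) (by exact hnum) (by exact hsav)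
      (by exact htmp) (by exact hl) (by rfl)).seq (Run.push .lft true _))).congr ?_ ?_
    · simp [Store.get, Store.set, hl, blockBits, ones_succ]
    · rw [length_blockTable]
      lia
  · refine ((run_copyVar s hvar v i a).seq ((h₁ _ (by exact hr)).seq
      ((run_blockRows n v l r (blockTable (some b)) (blockTable_length _) _
      (fun _ _ _ => ⟨by rfl, v.2⟩) (by exact hnum) (by exact hsav) (by exact htmp) (by exact hl)
      (by rfl)).seq ((run_clear v _ (by rfl)).seq (Run.push .lft true _))))).congr ?_ ?_
    · simp [Store.get, Store.set, hl, hvar, blockBits, ones_succ]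
    · rw [length_blockTable]
      have := v.2
      lia

/-- The rows of all blocks. -/
def allBlockBits {n : ℕ} (toks : List (Option (Fin n × Bool))) (k : ℕ) : List Bool :=
  (List.range k).flatMap fun j => blockBits j (toks.length - 1 - j) (toks[j]?.getD none)

/-- During the scan `lft` and `rgt` count the tokens before and after the current position, which
fixes the number of zero blocks on both sides of a row. This is the last pass over the formula, so
`aux` is not rewound. -/
theorem run_scan_block {n : ℕ} (cs : List (List (Fin n × Bool))) (s : Store)
    (hinp : s.inp = encodeClauses cs) (haux : s.aux = []) (hnum : s.num = ones n)
    (hvar : s.var = []) (hsav : s.sav = []) (htmp : s.tmp = []) (hl : s.lft = [])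
    (hr : s.rgt = ones (tokens cs).length) :
    Run (scan (block (some true)) (block (some false)) (block none)) s
      { s with
        inp := []
        aux := (encodeClauses cs).reverse
        out := (allBlockBits (tokens cs) (tokens cs).length).reverse ++ s.out
        lft := ones (tokens cs).length
        rgt := [] }
      ((tokens cs).length * (n * 61 + (tokens cs).length * 36 + 134) + 2) := by
  have key : ∀ p t rest, p ++ t :: rest = tokens cs → ∀ i a,
      Run (block (t.map Prod.snd))
        { s with
          inp := t.elim [] (fun x => encodeUnary x.1) ++ i
          aux := a
          out := (allBlockBits (tokens cs) p.length).reverse ++ s.out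
          lft := ones p.length
          rgt := ones ((tokens cs).length - p.length) }
        { s with
          inp := i
          aux := t.elim [] (fun x => (encodeUnary x.1).reverse) ++ a
          out := (allBlockBits (tokens cs) (p ++ [t]).length).reverse ++ s.out
          lft := ones (p ++ [t]).length
          rgt := ones ((tokens cs).length - (p ++ [t]).length) }
        (n * 61 + (tokens cs).length * 36 + 130) := by
    intro p t rest hp i a
    have hlen : (tokens cs).length = p.length + (rest.length + 1) := by
      rw [← hp]
      simp
    refine (run_block t p.length rest.length
      { s with
        out := (allBlockBits (tokens cs) p.length).reverse ++ s.out
        lft := ones p.length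
        rgt := ones ((tokens cs).length - p.length) }
      hnum hvar hsav htmp rfl ?_ i a).congr ?_ (by lia)
    · simp [hlen]
    · have e₁ : (tokens cs)[p.length]?.getD none = t := by
        rw [← hp]
        simp
      have e₂ : (tokens cs).length - 1 - p.length = rest.length := by lia
      have e₃ : (tokens cs).length - (p.length + 1) = rest.length := by lia
      simp [allBlockBits, List.range_succ, e₁, e₂, e₃]
  have h := run_scan cs (fun p => { s with
      out := (allBlockBits (tokens cs) p.length).reverse ++ s.out
      lft := ones p.length
      rgt := ones ((tokens cs).length - p.length) })
    (lp := block (some true)) (ln := block (some false)) (fin := block none)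
    (T := n * 61 + (tokens cs).length * 36 + 130)
    (fun p v b rest hp i a => by
      have := key p (some (v, b)) rest hp i a
      cases b <;> exact this)
    (fun p rest hp i a => key p none rest hp i a) [] []
  obtain ⟨⟩ := s
  simp only at hinp haux hl hr
  subst hinp haux hl hr
  simpa [allBlockBits] using h

/-- The program of the reduction; it also writes the parameter if `given` says so. -/
def reduction (given : Bool) : Cmd :=
  readNum ;; countTokens ;; header given ;; varRows ;;
  plainRow true [false, true, false, false, true, false] [false] ;;
  plainRow true [true, false, false, false, false, true] [false] ;;
  kindRow [false, false, false, false, true, false]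
    (fun t => t.elim [false, true, false, false] fun b => cond b (pairBits true) zeros) ;;
  kindRow [false, false, false, false, false, true]
    (fun t => t.elim [false, false, false, true] fun b => cond b zeros (pairBits false)) ;;
  plainRow false [true, false, true, false, false, true] [false] ;;
  plainRow false [false, true, false, true, true, false, true] [] ;;
  scan (block (some true)) (block (some false)) (block none) ;;
  rep .num [false] ;; emit [false, false, false, false, false] ;; rep .lft zeros ;;
  emit [true, false] ;; .drain .aux .skip .skip ;; clear .num ;; clear .lft

/-- The rows of the adjacency matrix written by the program of the reduction. -/
def matrixBits {n : ℕ} (toks : List (Option (Fin n × Bool))) : List Bool :=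
  (List.range n).flatMap (varRowBits toks) ++
  (List.replicate n true ++ [false, true, false, false, true, false] ++
    (List.replicate toks.length zeros).flatten ++ [false]) ++
  (List.replicate n true ++ [true, false, false, false, false, true] ++
    (List.replicate toks.length zeros).flatten ++ [false]) ++
  (List.replicate n false ++ [false, false, false, false, true, false] ++
    toks.flatMap (fun t => (t.map Prod.snd).elim [false, true, false, false]
      fun b => cond b (pairBits true) zeros) ++ [false]) ++
  (List.replicate n false ++ [false, false, false, false, false, true] ++
    toks.flatMap (fun t => (t.map Prod.snd).elim [false, false, false, true]
      fun b => cond b zeros (pairBits false)) ++ [false]) ++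
  (List.replicate n false ++ [true, false, true, false, false, true] ++
    (List.replicate toks.length zeros).flatten ++ [false]) ++
  (List.replicate n false ++ [false, true, false, true, true, false, true] ++
    (List.replicate toks.length zeros).flatten) ++
  allBlockBits toks toks.length ++
  (List.replicate n false ++ [false, false, false, false, false] ++
    (List.replicate toks.length zeros).flatten ++ [true, false])

theorem run_drain_aux (s : Store) (a : List Bool) :
    Run (.drain .aux .skip .skip) { s with aux := a } { s with aux := [] } (a.length * 2 + 1) := by
  induction a with
  | nil => exact Run.drainDone rfl
  | cons b a ih =>
    have h : Run (.drain .aux .skip .skip) { s with aux := b :: a }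
        { s with aux := [] } (1 + 1 + (a.length * 2 + 1)) := by
      cases b
      · exact Run.drainFalse (s := { s with aux := false :: a }) rfl (Run.skip _) ih
      · exact Run.drainTrue (s := { s with aux := true :: a }) rfl (Run.skip _) ih
    refine h.mono ?_
    simp only [List.length_cons]
    lia

/-- The bound is cubic because for each of the `n` variable rows the variable is compared with every
token, and a comparison takes time linear in `n`. The number `B` bounds all three sizes at once,
which leaves a single quantity to compare with the input length. -/
theorem run_reduction (given : Bool) {n : ℕ} (cs : List (List (Fin n × Bool))) (B : ℕ)
    (hn : n ≤ B) (hm : (tokens cs).length ≤ B) (hB : (encodeClauses cs).length ≤ B) :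
    Run (reduction given) (.ofInput (encodeUnary n ++ encodeClauses cs))
      (.ofOutput (cond given (encodeUnary (n + 5)) [] ++
        encodeUnary (n + 7 + 4 * (tokens cs).length) ++ matrixBits (tokens cs)).reverse)
      (1000 * (B + 1) ^ 3) := by
  have hf₁ : ∀ t : Option Bool, (t.elim [false, true, false, false]
      fun b => cond b (pairBits true) zeros).length ≤ 4 := by
    rintro (_ | _ | _) <;> simp [pairBits, zeros]
  have hf₂ : ∀ t : Option Bool, (t.elim [false, false, false, true]
      fun b => cond b zeros (pairBits false)).length ≤ 4 := by
    rintro (_ | _ | _) <;> simp [pairBits, zeros]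
  let st : List Bool → Store := fun o =>
    ⟨encodeClauses cs, [], o, ones n, [], [], [], [], [], [], ones (tokens cs).length⟩
  have h₂ : Run countTokens ⟨encodeClauses cs, [], [], ones n, ones n, [], [], [], [], [], []⟩
      ⟨encodeClauses cs, [], [], ones n, ones n, [], [], [], [], [], ones (tokens cs).length⟩ _ :=
    run_countTokens cs _ rfl rfl rfl
  have h₃ : Run (header given)
      ⟨encodeClauses cs, [], [], ones n, ones n, [], [], [], [], [], ones (tokens cs).length⟩
      ⟨encodeClauses cs, [], (cond given (encodeUnary (n + 5)) [] ++
        encodeUnary (n + 7 + 4 * (tokens cs).length)).reverse ++ [], ones n, ones n, [], [], [], [],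
        [], ones (tokens cs).length⟩ _ :=
    run_header given _ n (tokens cs).length rfl rfl rfl
  have h₄ : ∀ o, Run varRows
      ⟨encodeClauses cs, [], o, ones n, ones n, [], [], [], [], [], ones (tokens cs).length⟩
      (st (((List.range n).flatMap (varRowBits (tokens cs))).reverse ++ o)) _ :=
    fun o => run_varRows cs _ rfl rfl rfl rfl rfl rfl rfl rfl
  have h₅ : ∀ b l l' o, Run (plainRow b l l') (st o) (st ((List.replicate n b ++ l ++
      (List.replicate (tokens cs).length zeros).flatten ++ l').reverse ++ o)) _ :=
    fun b l l' o => run_plainRow b l l' (st o) n (tokens cs).length rfl rfl rfl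
  have h₆ : ∀ l f, (∀ x : Option Bool, (f x).length ≤ 4) → ∀ o,
      Run (kindRow l f) (st o) (st ((List.replicate n false ++ l ++
        (tokens cs).flatMap (fun t => f (t.map Prod.snd)) ++ [false]).reverse ++ o)) _ :=
    fun l f hf o => run_kindRow cs l f hf (st o) rfl rfl rfl rfl
  have h₇ : ∀ o, Run (scan (block (some true)) (block (some false)) (block none)) (st o)
      ⟨[], (encodeClauses cs).reverse, (allBlockBits (tokens cs) (tokens cs).length).reverse ++ o,
        ones n, [], [], [], [], [], ones (tokens cs).length, []⟩ _ :=
    fun o => run_scan_block cs (st o) rfl rfl rfl rfl rfl rfl rfl rfl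
  let fi : List Bool → Store := fun o =>
    ⟨[], (encodeClauses cs).reverse, o, ones n, [], [], [], [], [], ones (tokens cs).length, []⟩
  have h₈ : ∀ o, Run (rep .num [false]) (fi o)
      (fi ((List.replicate n [false]).flatten.reverse ++ o)) _ :=
    fun o => run_rep (.inl rfl) [false] (s := fi o) (k := n) rfl rfl
  have h₉ : ∀ o, Run (rep .lft zeros) (fi o)
      (fi ((List.replicate (tokens cs).length zeros).flatten.reverse ++ o)) _ :=
    fun o => run_rep (.inr (.inl rfl)) zeros (s := fi o) (k := (tokens cs).length) rfl rfl
  have h₁₀ : ∀ l o, Run (emit l) (fi o) (fi (l.reverse ++ o)) _ := fun l o => run_emit l (fi o)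
  have h₁₁ : ∀ o, Run (.drain .aux .skip .skip ;; clear .num ;; clear .lft) (fi o) (.ofOutput o) _ :=
    fun o => (run_drain_aux (fi o) (encodeClauses cs).reverse).seq
      ((run_clear n ⟨[], [], o, ones n, [], [], [], [], [], ones (tokens cs).length, []⟩ rfl).seq
        (run_clear (tokens cs).length
          ⟨[], [], o, [], [], [], [], [], [], ones (tokens cs).length, []⟩ rfl))
  refine ((run_readNum n (encodeClauses cs)).seq (h₂.seq (h₃.seq ((h₄ _).seq ((h₅ _ _ _ _).seq
    ((h₅ _ _ _ _).seq ((h₆ _ _ hf₁ _).seq ((h₆ _ _ hf₂ _).seq ((h₅ _ _ _ _).seq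
    ((h₅ _ _ _ _).seq ((h₇ _).seq ((h₈ _).seq ((h₁₀ _ _).seq ((h₉ _).seq ((h₁₀ _ _).seq
    (h₁₁ _)))))))))))))))).congr ?_ ?_
  · refine congrArg Store.ofOutput ?_
    simp [matrixBits]
  · clear h₂ h₃ h₄ h₅ h₆ h₇ h₈ h₉ h₁₀ h₁₁
    simp only [List.length_cons, List.length_nil, List.length_reverse, zeros]
    generalize (tokens cs).length = m at *
    generalize (encodeClauses cs).length = L at *
    have h₁ : m * n ≤ B * B := Nat.mul_le_mul hm hn
    have h₂ : n * n ≤ B * B := Nat.mul_le_mul hn hn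
    have h₃ : n * (m * n) ≤ B * (B * B) := Nat.mul_le_mul hn h₁
    have h₄ : n * L ≤ B * B := Nat.mul_le_mul hn hB
    have h₅ : m * m ≤ B * B := Nat.mul_le_mul hm hm
    have h₆ : m * n * n ≤ B * B * B := Nat.mul_le_mul h₁ hn
    have h₇ : n * m ≤ B * B := Nat.mul_le_mul hn hm
    have h₈ := Nat.zero_le (B * B)
    have h₉ := Nat.zero_le (B * B * B)
    linarith

end StackProg

/-! ### The graph of the reduction -/

namespace SatGraph

/-- The vertices: one for every variable, the fixed vertices, four for every token. -/
inductive Vert (n m : ℕ)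
  | x (i : Fin n)
  | P | Q | T | F | R | S
  | blk (j : Fin m) (a : Fin 4)
  | z
  deriving DecidableEq

variable {n m : ℕ}

/-- The vertices of a block that represent a literal of sign `b`. -/
def inPair (b : Bool) (a : Fin 4) : Bool := ![b, true, !b, false] a

/-- The vertices of a block that are adjacent to `T`. -/
def onT : Option (Fin n × Bool) → Fin 4 → Bool
  | none, a => ![false, true, false, false] a
  | some (_, b), a => b && inPair b a

/-- The vertices of a block that are adjacent to `F`. -/
def onF : Option (Fin n × Bool) → Fin 4 → Bool
  | none, a => ![false, false, false, true] a
  | some (_, b), a => !b && inPair b a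

/-- The vertices of a block that are adjacent to the variable `i`. -/
def onX (i : Fin n) : Option (Fin n × Bool) → Fin 4 → Bool
  | none, _ => false
  | some (i', b), a => decide (i' = i) && inPair b a

/-- The position of a vertex on the path that remains when the variables and the vertices
`P`, `Q`, `T`, `F` are deleted. -/
def pos : Vert n m → Option ℕ
  | .R => some 0
  | .S => some 1
  | .blk j a => some (4 * j + a + 2)
  | .z => some (4 * m + 2)
  | _ => none

/-- The vertices that are not adjacent to their successor on the path. -/
def broken (tok : Fin m → Option (Fin n × Bool)) : Vert n m → Bool
  | .blk j a => (tok j).isNone && decide (a = 1)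
  | _ => false

/-- The edges of the graph, in one direction. -/
def link (tok : Fin m → Option (Fin n × Bool)) : Vert n m → Vert n m → Bool
  | .x _, .P => true
  | .x _, .Q => true
  | .P, .Q => true
  | .P, .R => true
  | .T, .R => true
  | .Q, .S => true
  | .F, .S => true
  | .x i, .blk j a => onX i (tok j) a
  | .T, .blk j a => onT (tok j) a
  | .F, .blk j a => onF (tok j) a
  | .R, .S => true
  | .S, v => decide (pos v = some 2)
  | .blk j a, v => decide (pos v = some (4 * (j : ℕ) + a + 3)) && !broken tok (.blk j a)
  | _, _ => false

/-- The graph of the reduction. -/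
def graph (tok : Fin m → Option (Fin n × Bool)) : SimpleGraph (Vert n m) where
  Adj u v := (link tok u v || link tok v u) = true
  symm := ⟨fun u v h => by rwa [Bool.or_comm]⟩
  loopless := ⟨fun u => by cases u <;> simp [link, pos]⟩

variable (tok : Fin m → Option (Fin n × Bool))

theorem adj_iff (u v : Vert n m) :
    (graph tok).Adj u v ↔ link tok u v = true ∨ link tok v u = true := by
  simp [graph]

theorem adj_blk_blk (j : Fin m) (a : Fin 4) (j' : Fin m) (a' : Fin 4) :
    (graph tok).Adj (.blk j a) (.blk j' a') ↔
    (4 * (j' : ℕ) + a' = 4 * j + a + 1 ∧ ¬ (tok j = none ∧ a = 1)) ∨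
    (4 * (j : ℕ) + a = 4 * j' + a' + 1 ∧ ¬ (tok j' = none ∧ a' = 1)) := by
  have h : ∀ x y : ℕ, x + 2 = y + 3 ↔ x = y + 1 := by lia
  simp only [adj_iff, link, pos, broken, Bool.and_eq_true, decide_eq_true_eq, Option.some.injEq, h,
    Bool.not_eq_true', Bool.and_eq_false_iff, Option.isNone_eq_false_iff, Option.isSome_iff_ne_none,
    decide_eq_false_iff_not, not_and_or]

end SatGraph

/-! ### Edges and triangles that are maximal cliques -/

namespace SimpleGraph

variable {V : Type*} {G : SimpleGraph V}

theorem mem_of_maximal_isClique {X : Set V} (hX : Maximal G.IsClique X) {w : V}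
    (h : ∀ y ∈ X, y ≠ w → G.Adj y w) : w ∈ X :=
  hX.2 (hX.1.insert fun y hy hne => (h y hy hne.symm).symm) (Set.subset_insert w X)
    (Set.mem_insert w X)

/-- An edge without common neighbor is itself a maximal clique. -/
theorem IsCliqueColoring.ne {q : ℕ} {f : V → Fin q} (hf : G.IsCliqueColoring f) {u v : V}
    (huv : G.Adj u v) (h : ∀ w, G.Adj w u → ¬ G.Adj w v) : f u ≠ f v := by
  intro he
  refine hf {u, v} ⟨?_, ?_⟩ ⟨f u, ?_⟩
  · exact isClique_pair.2 fun _ => huv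
  · intro Y hY hle y hy
    by_contra hne
    simp only [Set.mem_insert_iff, Set.mem_singleton_iff, not_or] at hne
    exact h y (hY hy (hle (by simp)) hne.1) (hY hy (hle (by simp)) hne.2)
  · simp [he]

/-- A triangle without common neighbor is itself a maximal clique. The conclusion is in the form
needed for pairs: once two vertices agree, the apex differs. -/
theorem IsCliqueColoring.not_mono {q : ℕ} {f : V → Fin q} (hf : G.IsCliqueColoring f) {u v w : V}
    (huv : G.Adj u v) (huw : G.Adj u w) (hvw : G.Adj v w)
    (h : ∀ y, G.Adj y u → G.Adj y v → ¬ G.Adj y w) (he : f u = f v) : f u ≠ f w := by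
  intro he'
  refine hf {u, v, w} ⟨?_, ?_⟩ ⟨f u, ?_⟩
  · rw [isClique_iff, Set.Pairwise]
    simp only [Set.mem_insert_iff, Set.mem_singleton_iff]
    rintro a (rfl | rfl | rfl) b (rfl | rfl | rfl) hab <;>
      first | exact absurd rfl hab | assumption | (apply Adj.symm; assumption)
  · intro Y hY hle y hy
    by_contra hne
    simp only [Set.mem_insert_iff, Set.mem_singleton_iff, not_or] at hne
    exact h y (hY hy (hle (by simp)) hne.1) (hY hy (hle (by simp)) hne.2.1)
      (hY hy (hle (by simp)) hne.2.2)
  · simp [he, ← he']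

end SimpleGraph

/-! ### Triangles over the edges of the path -/

namespace SatGraph

variable {n m : ℕ} {tok : Fin m → Option (Fin n × Bool)}

/-- The path has no triangles, `S` and `z` see at most one block vertex each, and `P`, `Q`, `R` see
none. Only variables, `T` and `F` remain as possible apexes over two consecutive block vertices. -/
theorem common_neighbor {j j' : Fin m} {a a' : Fin 4} (hpos : 4 * (j' : ℕ) + a' = 4 * j + a + 1)
    {y : Vert n m} (h : (graph tok).Adj y (.blk j a)) (h' : (graph tok).Adj y (.blk j' a')) :
    (∃ i, y = .x i ∧ onX i (tok j) a = true ∧ onX i (tok j') a' = true) ∨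
    (y = .T ∧ onT (tok j) a = true ∧ onT (tok j') a' = true) ∨
    (y = .F ∧ onF (tok j) a = true ∧ onF (tok j') a' = true) := by
  cases y with
  | blk k b =>
    rw [adj_blk_blk] at h h'
    lia
  | S =>
    simp [adj_iff, link, pos] at h h'
    lia
  | z =>
    simp [adj_iff, link, pos] at h h'
    lia
  | _ => simp_all [adj_iff, link, pos]

/-- The vertex before the block of a token. -/
def prev (j : Fin m) : Vert n m :=
  if h : (j : ℕ) = 0 then .S else .blk ⟨j - 1, by lia⟩ 3

theorem prev_zero {j : Fin m} (h : (j : ℕ) = 0) : (prev j : Vert n m) = .S := by simp [prev, h]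

theorem prev_succ {j j' : Fin m} (h : (j' : ℕ) = j + 1) : (prev j' : Vert n m) = .blk j 3 := by
  simp [prev, h]

theorem adj_prev (j : Fin m) : (graph tok).Adj (prev j) (.blk j 0) := by
  unfold prev
  split_ifs with h
  · simp [adj_iff, link, pos, h]
  · rw [adj_blk_blk]
    left
    refine ⟨?_, by simp⟩
    simp
    lia

@[simp] theorem onF_zero (t : Option (Fin n × Bool)) : onF t 0 = false := by
  rcases t with _ | ⟨i, _ | _⟩ <;> simp [onF, inPair]

@[simp] theorem onT_three (t : Option (Fin n × Bool)) : onT t 3 = false := by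
  rcases t with _ | ⟨i, _ | _⟩ <;> simp [onT, inPair]

@[simp] theorem onX_three (i : Fin n) (t : Option (Fin n × Bool)) : onX i t 3 = false := by
  rcases t with _ | ⟨i, _ | _⟩ <;> simp [onX, inPair]

/-! ### From a clique coloring to an assignment -/

section Sound

variable {f : Vert n m → Fin 2}

theorem color_T_ne_R (hf : (graph tok).IsCliqueColoring f) : f .T ≠ f .R := by
  refine hf.ne (by simp [adj_iff, link]) ?_
  intro y h h'
  cases y <;> simp [adj_iff, link, pos, broken] at h h'

theorem color_R_ne_S (hf : (graph tok).IsCliqueColoring f) : f .R ≠ f .S := by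
  refine hf.ne (by simp [adj_iff, link]) ?_
  intro y h h'
  cases y <;> simp [adj_iff, link, pos, broken] at h h'

theorem color_F_ne_S (hf : (graph tok).IsCliqueColoring f) : f .F ≠ f .S := by
  refine hf.ne (by simp [adj_iff, link]) ?_
  intro y h h'
  cases y with
  | blk j a =>
    simp [adj_iff, link, pos, broken] at h h'
    -- The only block vertex that may be adjacent to `S` is the first one of a block, and such a
    -- vertex is never adjacent to `F`.
    obtain rfl : a = 0 := by
      apply Fin.ext
      simp
      lia
    simp at h
  | _ => simp [adj_iff, link, pos] at h h'

theorem color_S (hf : (graph tok).IsCliqueColoring f) : f .S = f .T := by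
  have h₁ := color_T_ne_R hf
  have h₂ := color_R_ne_S hf
  lia

theorem color_F (hf : (graph tok).IsCliqueColoring f) : f .F ≠ f .T := by
  rw [← color_S hf]
  exact color_F_ne_S hf

/-- The blocks are laid out so that no triangle crosses their boundary: the last vertex of a block
is adjacent neither to `T` nor to a variable, and the first one is not adjacent to `F`. This is why
negative literals use the two middle vertices of their block. -/
theorem color_prev_ne (hf : (graph tok).IsCliqueColoring f) (j : Fin m) :
    f (prev j) ≠ f (.blk j 0) := by
  refine hf.ne (adj_prev j) fun y h h' => ?_
  unfold prev at h
  split_ifs at h with hj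
  · cases y with
    | blk k b =>
      simp [adj_iff, link, pos] at h
      rw [adj_blk_blk] at h'
      simp at h'
      lia
    | z =>
      simp [adj_iff, link, pos] at h
      exact absurd j.2 (by lia)
    | _ => simp [adj_iff, link, pos] at h h'
  · rcases common_neighbor (by simp; lia) h h' with ⟨i, -, h, -⟩ | ⟨-, h, -⟩ | ⟨-, -, h⟩ <;>
      simp at h

/-- Consecutive vertices of a block without a common neighbor get different colors. -/
theorem color_blk_ne (hf : (graph tok).IsCliqueColoring f) (j : Fin m) {a a' : Fin 4}
    (ha : (a' : ℕ) = a + 1) (hbr : ¬ (tok j = none ∧ a = 1))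
    (hx : ∀ i, onX i (tok j) a = true → onX i (tok j) a' = false)
    (hT : onT (tok j) a = true → onT (tok j) a' = false)
    (hF : onF (tok j) a = true → onF (tok j) a' = false) :
    f (.blk j a) ≠ f (.blk j a') := by
  refine hf.ne ?_ fun y h₁ h₂ => ?_
  · rw [adj_blk_blk]
    exact .inl ⟨by lia, hbr⟩
  · rcases common_neighbor (by lia) h₁ h₂ with ⟨i, -, h₁, h₂⟩ | ⟨-, h₁, h₂⟩ | ⟨-, h₁, h₂⟩
    · simp [hx i h₁] at h₂
    · simp [hT h₁] at h₂
    · simp [hF h₁] at h₂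

/-- The block of a clause end. -/
theorem color_end (hf : (graph tok).IsCliqueColoring f) {j : Fin m} (hj : tok j = none) :
    f (prev j) ≠ f .T ∧ f (.blk j 3) = f .T := by
  have h₀ := color_prev_ne hf j
  have h₁ : f (.blk j 0) ≠ f (.blk j 1) :=
    color_blk_ne hf j rfl (by simp) (by simp [hj, onX]) (by simp [hj, onT]) (by simp)
  -- Because of the gap, the only neighbor of this vertex on the path is the first vertex of the
  -- block, which is not adjacent to `T`.
  have h₂ : f .T ≠ f (.blk j 1) := by
    refine hf.ne (by simp [adj_iff, link, hj, onT]) fun y h h' => ?_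
    cases y with
    | blk k b =>
      rw [adj_blk_blk] at h'
      simp [adj_iff, link, pos] at h
      simp [hj] at h'
      obtain ⟨rfl, rfl⟩ : k = j ∧ b = 0 := by
        constructor
        · apply Fin.ext
          lia
        · apply Fin.ext
          simp
          lia
      simp [hj, onT] at h
    | _ => simp [adj_iff, link, pos] at h h'
  have h₃ : f .F ≠ f (.blk j 3) := by
    refine hf.ne (by simp [adj_iff, link, hj, onF]) fun y h h' => ?_
    cases y with
    | blk k b =>
      rw [adj_blk_blk] at h'
      simp [adj_iff, link, pos] at h
      simp at h'
      obtain ⟨rfl, rfl⟩ | rfl : (k = j ∧ b = 2) ∨ b = 0 := by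
        rcases h' with h' | h'
        · left
          constructor
          · apply Fin.ext
            lia
          · apply Fin.ext
            simp
            lia
        · right
          apply Fin.ext
          simp
          lia
      · simp [hj, onF] at h
      · simp at h
    | S =>
      simp [adj_iff, link, pos] at h'
    | _ => simp [adj_iff, link] at h h'
  have h₄ := color_F hf
  -- With two colors, vertex 1 has the color of `F`, so vertex 0 has that of `T` and the vertex
  -- before the block that of `F`; vertex 3 avoids the color of `F`.
  constructor <;> lia

/-- The pair of vertices that stands for a literal can get a single color only if the literal is
true. -/
theorem color_pair (hf : (graph tok).IsCliqueColoring f) {j : Fin m} {i : Fin n} {b : Bool}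
    (hj : tok j = some (i, b)) {a a' : Fin 4} (ha : (a' : ℕ) = a + 1) (hp : inPair b a = true)
    (hp' : inPair b a' = true) (he : f (.blk j a) = f (.blk j a')) :
    f (.x i) = f .T ↔ b = true := by
  have h₀ : (graph tok).Adj (.blk j a) (.blk j a') := by
    rw [adj_blk_blk]
    exact .inl ⟨by lia, by simp [hj]⟩
  -- The pair forms a maximal triangle with `x i` and another with `T` or `F`. The common color of
  -- the pair is avoided by both apexes, so these have the same color.
  have h₁ : f (.blk j a) ≠ f (.x i) := by
    refine hf.not_mono h₀ ?_ ?_ ?_ he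
    · simp [adj_iff, link, hj, onX, hp]
    · simp [adj_iff, link, hj, onX, hp']
    · intro y h h' h''
      rcases common_neighbor (by lia) h h' with ⟨i, rfl, -⟩ | ⟨rfl, -⟩ | ⟨rfl, -⟩ <;>
        simp [adj_iff, link] at h''
  have h₂ := color_F hf
  cases b
  · have h₃ : f (.blk j a) ≠ f .F := by
      refine hf.not_mono h₀ ?_ ?_ ?_ he
      · simp [adj_iff, link, hj, onF, hp]
      · simp [adj_iff, link, hj, onF, hp']
      · intro y h h' h''
        rcases common_neighbor (by lia) h h' with ⟨i, rfl, -⟩ | ⟨rfl, -⟩ | ⟨rfl, -⟩ <;>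
          simp [adj_iff, link] at h''
    simp only [Bool.false_eq_true, iff_false]
    lia
  · have h₃ : f (.blk j a) ≠ f .T := by
      refine hf.not_mono h₀ ?_ ?_ ?_ he
      · simp [adj_iff, link, hj, onT, hp]
      · simp [adj_iff, link, hj, onT, hp']
      · intro y h h' h''
        rcases common_neighbor (by lia) h h' with ⟨i, rfl, -⟩ | ⟨rfl, -⟩ | ⟨rfl, -⟩ <;>
          simp [adj_iff, link] at h''
    simp only [iff_true]
    lia

/-- The block of a literal that is not true. -/
theorem color_lit (hf : (graph tok).IsCliqueColoring f) {j : Fin m} {i : Fin n} {b : Bool}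
    (hj : tok j = some (i, b)) (hb : ¬ (f (.x i) = f .T ↔ b = true)) (hp : f (prev j) = f .T) :
    f (.blk j 3) = f .T := by
  have h₀ := color_prev_ne hf j
  have h₁ : f (.blk j 0) ≠ f (.blk j 1) := by
    cases b
    · exact color_blk_ne hf j rfl (by simp) (by simp [hj, onX, inPair]) (by simp [hj, onT, inPair])
        (by simp [hj, onF, inPair])
    · exact fun he => hb (color_pair hf hj rfl rfl rfl he)
  have h₂ : f (.blk j 1) ≠ f (.blk j 2) := by
    cases b
    · exact fun he => hb (color_pair hf hj rfl rfl rfl he)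
    · exact color_blk_ne hf j rfl (by simp [hj]) (by simp [hj, onX, inPair])
        (by simp [hj, onT, inPair]) (by simp [hj, onF, inPair])
  have h₃ : f (.blk j 2) ≠ f (.blk j 3) :=
    color_blk_ne hf j rfl (by simp) (by simp) (by simp) (by simp [hj, onF, inPair])
  -- Four changes of color lead from the vertex before the block back to the color of `T`.
  lia

end Sound

end SatGraph

namespace SatGraph

variable {n m : ℕ} {tok : Fin m → Option (Fin n × Bool)}

/-! ### From an assignment to a clique coloring -/

/-- Whether the current clause is satisfied after one more token. -/
def nextState (asg : Fin n → Bool) (s : Bool) : Option (Fin n × Bool) → Bool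
  | none => false
  | some (i, b) => s || decide (asg i = b)

/-- The colors of a block, where `s` says whether the clause is satisfied by earlier literals. -/
def blockColor (asg : Fin n → Bool) (s : Bool) : Option (Fin n × Bool) → Fin 4 → Bool
  | none, a => ![true, false, false, true] a
  | some (i, b), a =>
    if s then ![true, false, true, false] a
    else if asg i = b then ![false, !b, true, false] a
    else ![false, true, false, true] a

/-- The coloring that belongs to an assignment. -/
def color (tok : Fin m → Option (Fin n × Bool)) (asg : Fin n → Bool) (st : ℕ → Bool) :
    Vert n m → Bool
  | .x i => asg i
  | .P => true
  | .Q => false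
  | .T => true
  | .F => false
  | .R => false
  | .S => true
  | .blk j a => blockColor asg (st j) (tok j) a
  | .z => st m

variable {asg : Fin n → Bool} {st : ℕ → Bool}

/-- This and `blockColor_zero` are the invariant of the coloring: a block starts with the current
state as its color and ends with the negation of the next state, so the colors on the two sides of a
block boundary always differ. -/
theorem blockColor_three (s : Bool) (t : Option (Fin n × Bool)) :
    blockColor asg s t 3 = !nextState asg s t := by
  rcases t with _ | ⟨i, b⟩
  · rfl
  · by_cases h : asg i = b <;> cases s <;> simp [blockColor, nextState, h]

theorem blockColor_zero {s : Bool} {t : Option (Fin n × Bool)} (h : t = none → s = true) :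
    blockColor asg s t 0 = s := by
  rcases t with _ | ⟨i, b⟩
  · simp [blockColor, h]
  · by_cases h : asg i = b <;> cases s <;> simp [blockColor]

/-- Consecutive vertices of a block have different colors unless they stand for a true literal. -/
theorem blockColor_eq {s : Bool} {t : Option (Fin n × Bool)} {a a' : Fin 4}
    (ha : (a' : ℕ) = a + 1) (hbr : ¬ (t = none ∧ a = 1))
    (he : blockColor asg s t a = blockColor asg s t a') :
    ∃ i b, t = some (i, b) ∧ asg i = b ∧ inPair b a = true ∧ inPair b a' = true ∧
      blockColor asg s t a = !b := by
  rcases t with _ | ⟨i, b⟩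
  · fin_cases a <;> fin_cases a' <;> simp_all [blockColor]
  · refine ⟨i, b, rfl, ?_⟩
    by_cases h : asg i = b
    · cases s <;> cases b <;> fin_cases a <;> fin_cases a' <;> simp_all [blockColor, inPair]
    · cases s <;> fin_cases a <;> fin_cases a' <;> simp_all [blockColor]

/-- Adjacent vertices of the path that have the same color stand for a true literal. -/
theorem color_chain (h₀ : st 0 = false) (hst : ∀ j : Fin m, st (j + 1) = nextState asg (st j) (tok j))
    (hend : ∀ j : Fin m, tok j = none → st j = true) {u v : Vert n m} {k l : ℕ}
    (hu : pos u = some k) (hv : pos v = some l) (hkl : l = k + 1) (huv : (graph tok).Adj u v)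
    (he : color tok asg st u = color tok asg st v) :
    ∃ (j : Fin m) (a a' : Fin 4) (i : Fin n) (b : Bool), u = .blk j a ∧ v = .blk j a' ∧
      (a' : ℕ) = a + 1 ∧ tok j = some (i, b) ∧ asg i = b ∧ inPair b a = true ∧
      inPair b a' = true ∧ color tok asg st u = !b := by
  subst hkl
  cases u with
  | R =>
    cases v <;> simp_all [pos, color]
    all_goals lia
  | S =>
    cases v with
    | blk j a =>
      simp [pos] at hu hv
      obtain ⟨hj, rfl⟩ : (j : ℕ) = 0 ∧ a = 0 := ⟨by lia, by apply Fin.ext; simp; lia⟩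
      simp [color, blockColor_zero (hend j)] at he
      simp [hj, h₀] at he
    | z =>
      simp [pos] at hu hv
      obtain rfl : m = 0 := by lia
      simp [color, h₀] at he
    | _ =>
      simp [pos] at hu hv
      try lia
  | blk j a =>
    cases v with
    | blk j' a' =>
      simp [pos] at hu hv
      have hpos : 4 * (j' : ℕ) + a' = 4 * j + a + 1 := by lia
      by_cases hj : j' = j
      · subst hj
        have hbr : ¬ (tok j' = none ∧ a = 1) := by
          rw [adj_blk_blk] at huv
          lia
        obtain ⟨i, b, h₁, h₂, h₃, h₄, h₅⟩ := blockColor_eq (by lia) hbr he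
        exact ⟨j', a, a', i, b, rfl, rfl, by lia, h₁, h₂, h₃, h₄, h₅⟩
      · obtain ⟨hj', rfl, rfl⟩ : (j' : ℕ) = j + 1 ∧ a = 3 ∧ a' = 0 := by
          have : (j' : ℕ) ≠ j := fun h => hj (Fin.ext h)
          refine ⟨by lia, ?_, ?_⟩ <;> apply Fin.ext <;> simp <;> lia
        simp only [color, blockColor_three, blockColor_zero (hend j'), ← hst] at he
        rw [hj'] at he
        simp at he
    | z =>
      simp [pos] at hu hv
      obtain ⟨hj, rfl⟩ : (j : ℕ) + 1 = m ∧ a = 3 := ⟨by lia, by apply Fin.ext; simp; lia⟩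
      simp [color, blockColor_three, ← hst, hj] at he
    | _ =>
      simp [pos] at hu hv
      try lia
  | z =>
    cases v <;> simp [pos] at hu hv <;> lia
  | _ => simp [pos] at hu

/-- Two members of a maximal clique force a third one into it. -/
theorem mem_of_maximal {V : Type*} {G : SimpleGraph V} {X : Set V} (hX : Maximal G.IsClique X)
    {u v w : V} (hu : u ∈ X) (hv : v ∈ X) (huw : G.Adj u w) (hvw : G.Adj v w)
    (h : ∀ y, y ≠ w → G.Adj y u → G.Adj y v → y ∈ X → G.Adj y w) : w ∈ X := by
  refine SimpleGraph.mem_of_maximal_isClique hX fun y hy hne => ?_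
  by_cases hyu : y = u
  · rwa [hyu]
  by_cases hyv : y = v
  · rwa [hyv]
  exact h y hne (hX.1 hy hu hyu) (hX.1 hy hv hyv) hy

theorem exists_partner {b : Bool} {a : Fin 4} (ha : inPair b a = true) :
    ∃ a' : Fin 4, inPair b a' = true ∧ ((a' : ℕ) = a + 1 ∨ (a : ℕ) = a' + 1) := by
  revert a b
  decide

theorem adj_of_pair {j : Fin m} {i : Fin n} {b : Bool} (hj : tok j = some (i, b)) {a a' : Fin 4}
    (h : (a' : ℕ) = a + 1 ∨ (a : ℕ) = a' + 1) : (graph tok).Adj (.blk j a) (.blk j a') := by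
  rw [adj_blk_blk]
  simp only [hj, reduceCtorEq, false_and, not_false_eq_true, and_true]
  lia

/-- A neighbor on the path of a vertex that stands for a literal is its partner or does not stand
for a literal. -/
theorem eq_partner {j k : Fin m} {b : Bool} {a a' c : Fin 4}
    (ha : inPair b a = true) (ha' : inPair b a' = true)
    (h : (a' : ℕ) = a + 1 ∨ (a : ℕ) = a' + 1) (hadj : (graph tok).Adj (.blk k c) (.blk j a))
    (hc : c ≠ 3) (hcb : k = j → inPair b c = true) : (Vert.blk k c : Vert n m) = .blk j a' := by
  rw [adj_blk_blk] at hadj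
  -- An edge between different blocks ends in the last vertex of the earlier one, and neither vertex
  -- here is a last vertex.
  have hkj : k = j := by
    apply Fin.ext
    have : a ≠ 3 := by
      rintro rfl
      simp [inPair] at ha
    have h₁ : (a : ℕ) ≠ 3 := fun h => this (Fin.ext h)
    have h₂ : (c : ℕ) ≠ 3 := fun h => hc (Fin.ext h)
    lia
  subst hkj
  have hca : (c : ℕ) = a + 1 ∨ (a : ℕ) = c + 1 := by lia
  replace hcb := hcb rfl
  have : c = a' := by
    clear hadj hc
    revert a a' b c
    decide
  rw [this]

section Complete

variable {X : Set (Vert n m)}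

/-- Apart from `Q` itself, every neighbor of `P` other than `R` is a variable and thus adjacent to
`Q`, and `R` has the wrong color. By maximality `Q` would belong to the clique, although `P` and `Q`
differ in color. -/
theorem P_notMem (hX : Maximal (graph tok).IsClique X)
    (hmono : ∀ u ∈ X, ∀ v ∈ X, color tok asg st u = color tok asg st v) : .P ∉ X := by
  intro hP
  have hQ : .Q ∉ X := fun hQ => by simpa [color] using hmono _ hP _ hQ
  refine hQ (mem_of_maximal hX hP hP ?_ ?_ fun y _ h _ hy => ?_)
  · simp [adj_iff, link]
  · simp [adj_iff, link]
  · cases y with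
    | R => simpa [color] using hmono _ hP _ hy
    | _ => simp_all [adj_iff, link, pos]

theorem Q_notMem (hX : Maximal (graph tok).IsClique X)
    (hmono : ∀ u ∈ X, ∀ v ∈ X, color tok asg st u = color tok asg st v) : .Q ∉ X := by
  intro hQ
  refine P_notMem hX hmono (mem_of_maximal hX hQ hQ ?_ ?_ fun y _ h _ hy => ?_)
  · simp [adj_iff, link]
  · simp [adj_iff, link]
  · cases y with
    | S => simpa [color] using hmono _ hQ _ hy
    | _ => simp_all [adj_iff, link, pos]

theorem color_of_pair_mem
    (hmono : ∀ u ∈ X, ∀ v ∈ X, color tok asg st u = color tok asg st v) {j : Fin m} {i : Fin n}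
    {b : Bool} (hj : tok j = some (i, b)) {a a' : Fin 4} (h : (a' : ℕ) = a + 1 ∨ (a : ℕ) = a' + 1)
    (ha : .blk j a ∈ X) (ha' : .blk j a' ∈ X) :
    asg i = b ∧ color tok asg st (.blk j a) = !b := by
  have he := hmono _ ha _ ha'
  rcases h with h | h
  · obtain ⟨i', b', h₁, h₂, -, -, h₃⟩ := blockColor_eq h (by simp [hj]) he
    simp only [hj, Option.some.injEq, Prod.mk.injEq] at h₁
    obtain ⟨rfl, rfl⟩ := h₁
    exact ⟨h₂, h₃⟩
  · obtain ⟨i', b', h₁, h₂, -, -, h₃⟩ := blockColor_eq h (by simp [hj]) he.symm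
    simp only [hj, Option.some.injEq, Prod.mk.injEq] at h₁
    obtain ⟨rfl, rfl⟩ := h₁
    exact ⟨h₂, he.trans h₃⟩

/-- A clique with `x i` and no block vertex could be enlarged by `P`. With a block vertex it must
contain the whole pair, by maximality; but a monochromatic pair has the color opposite to that of
its variable. -/
theorem x_notMem (hX : Maximal (graph tok).IsClique X)
    (hmono : ∀ u ∈ X, ∀ v ∈ X, color tok asg st u = color tok asg st v) (i : Fin n) :
    .x i ∉ X := by
  intro hi
  refine P_notMem hX hmono (mem_of_maximal hX hi hi ?_ ?_ fun y _ h _ hy => ?_)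
  · simp [adj_iff, link]
  · simp [adj_iff, link]
  · exfalso
    cases y with
    | Q => exact Q_notMem hX hmono hy
    | blk j a =>
      simp [adj_iff, link, pos] at h
      rcases hj : tok j with _ | ⟨i', b⟩
      · simp [hj, onX] at h
      simp [hj, onX] at h
      obtain ⟨rfl, ha⟩ := h
      obtain ⟨a', ha', haa'⟩ := exists_partner ha
      have hmem : .blk j a' ∈ X := by
        refine mem_of_maximal hX hi hy ?_ (adj_of_pair hj haa') fun y hne h h' hy => ?_
        · simp [adj_iff, link, hj, onX, ha']
        · cases y with
          | Q => exact absurd hy (Q_notMem hX hmono)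
          | blk k c =>
            refine absurd (eq_partner ha ha' haa' h' ?_ ?_) hne
            · rintro rfl
              simp [adj_iff, link, pos] at h
            · rintro rfl
              simpa [adj_iff, link, pos, hj, onX] using h
          | _ => simp [adj_iff, link, pos] at h h'
      obtain ⟨h₁, h₂⟩ := color_of_pair_mem hmono hj haa' hy hmem
      have := hmono _ hi _ hy
      rw [h₂] at this
      simp [color, h₁] at this
    | _ => simp_all [adj_iff, link, pos]

/-- A clique containing `T` but no block vertex could be enlarged by `R`, which has the other color.
At a clause end the neighbor of `T` has the other color too. At a positive literal the clique
contains the whole pair, which would then be colored `false`, unlike `T`. -/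
theorem T_notMem (hX : Maximal (graph tok).IsClique X)
    (hmono : ∀ u ∈ X, ∀ v ∈ X, color tok asg st u = color tok asg st v) : .T ∉ X := by
  intro hT
  have hR : .R ∉ X := fun hR => by simpa [color] using hmono _ hT _ hR
  refine hR (mem_of_maximal hX hT hT ?_ ?_ fun y _ h _ hy => ?_)
  · simp [adj_iff, link]
  · simp [adj_iff, link]
  · exfalso
    cases y with
    | blk j a =>
      simp [adj_iff, link, pos] at h
      rcases hj : tok j with _ | ⟨i, b⟩
      · have := hmono _ hT _ hy
        simp only [color, hj, blockColor] at this
        simp only [hj, onT] at h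
        clear * - this h
        revert a
        decide
      simp [hj, onT] at h
      obtain ⟨rfl, ha⟩ := h
      obtain ⟨a', ha', haa'⟩ := exists_partner ha
      have hmem : .blk j a' ∈ X := by
        refine mem_of_maximal hX hT hy ?_ (adj_of_pair hj haa') fun y hne h h' hy => ?_
        · simp [adj_iff, link, hj, onT, ha']
        · cases y with
          | blk k c =>
            refine absurd (eq_partner ha ha' haa' h' ?_ ?_) hne
            · rintro rfl
              simp [adj_iff, link, pos] at h
            · rintro rfl
              simpa [adj_iff, link, pos, hj, onT] using h
          | _ => simp [adj_iff, link, pos] at h h'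
      obtain ⟨-, h₂⟩ := color_of_pair_mem hmono hj haa' hy hmem
      have := hmono _ hT _ hy
      rw [h₂] at this
      simp [color] at this
    | R => exact hR hy
    | _ => simp_all [adj_iff, link, pos]

theorem F_notMem (hX : Maximal (graph tok).IsClique X)
    (hmono : ∀ u ∈ X, ∀ v ∈ X, color tok asg st u = color tok asg st v) : .F ∉ X := by
  intro hF
  have hS : .S ∉ X := fun hS => by simpa [color] using hmono _ hF _ hS
  refine hS (mem_of_maximal hX hF hF ?_ ?_ fun y _ h _ hy => ?_)
  · simp [adj_iff, link]
  · simp [adj_iff, link]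
  · exfalso
    cases y with
    | blk j a =>
      simp [adj_iff, link, pos] at h
      rcases hj : tok j with _ | ⟨i, b⟩
      · have := hmono _ hF _ hy
        simp only [color, hj, blockColor] at this
        simp only [hj, onF] at h
        clear * - this h
        revert a
        decide
      simp [hj, onF] at h
      obtain ⟨rfl, ha⟩ := h
      obtain ⟨a', ha', haa'⟩ := exists_partner ha
      have hmem : .blk j a' ∈ X := by
        refine mem_of_maximal hX hF hy ?_ (adj_of_pair hj haa') fun y hne h h' hy => ?_
        · simp [adj_iff, link, hj, onF, ha']
        · cases y with
          | blk k c =>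
            -- `F`, unlike `T` and the variables, can be adjacent to the last vertex of another
            -- block, a clause end. But the pair of a negative literal consists of the middle
            -- vertices 1 and 2, whose neighbors on the path all lie in the same block.
            by_cases hkj : k = j
            · subst hkj
              refine absurd (eq_partner ha ha' haa' h' ?_ fun _ => ?_) hne
              · rintro rfl
                simp [adj_iff, link, pos, hj, onF, inPair] at h
              · simpa [adj_iff, link, pos, hj, onF] using h
            · exfalso
              have hc : c ≠ 0 := by
                rintro rfl
                simp [adj_iff, link, pos] at h
              have ha₀ : a ≠ 0 := by
                rintro rfl
                simp [inPair] at ha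
              have ha₃ : a ≠ 3 := by
                rintro rfl
                simp [inPair] at ha
              rw [adj_blk_blk] at h'
              have h₁ : (a : ℕ) ≠ 3 := fun h => ha₃ (Fin.ext h)
              have h₂ : (a : ℕ) ≠ 0 := fun h => ha₀ (Fin.ext h)
              have h₃ : (k : ℕ) ≠ j := fun h => hkj (Fin.ext h)
              lia
          | S => exact absurd hy hS
          | _ => simp [adj_iff, link] at h h'
      obtain ⟨-, h₂⟩ := color_of_pair_mem hmono hj haa' hy hmem
      have := hmono _ hF _ hy
      rw [h₂] at this
      simp [color] at this
    | S => exact hS hy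
    | _ => simp_all [adj_iff, link]

theorem exists_neighbor (u : Vert n m) : ∃ v, (graph tok).Adj u v := by
  cases u with
  | x i => exact ⟨.P, by simp [adj_iff, link]⟩
  | P => exact ⟨.Q, by simp [adj_iff, link]⟩
  | Q => exact ⟨.P, by simp [adj_iff, link]⟩
  | T => exact ⟨.R, by simp [adj_iff, link]⟩
  | F => exact ⟨.S, by simp [adj_iff, link]⟩
  | R => exact ⟨.S, by simp [adj_iff, link]⟩
  | S => exact ⟨.R, by simp [adj_iff, link]⟩
  | blk j a =>
    -- The edges 0–1 and 2–3 exist in every block; the edge 1–2 is missing at a clause end.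
    refine ⟨.blk j (![1, 0, 3, 2] a), ?_⟩
    rw [adj_blk_blk]
    fin_cases a <;> simp
  | z =>
    by_cases hm : m = 0
    · exact ⟨.S, by simp [adj_iff, link, pos, hm]⟩
    · refine ⟨.blk ⟨m - 1, by lia⟩ 3, ?_⟩
      simp [adj_iff, link, pos, broken]
      lia

theorem pos_succ_of_adj {u v : Vert n m} {k l : ℕ} (hu : pos u = some k) (hv : pos v = some l)
    (h : (graph tok).Adj u v) : l = k + 1 ∨ k = l + 1 := by
  cases u <;> simp [pos] at hu <;> cases v <;> simp [pos] at hv <;>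
    simp [adj_iff, link, pos] at h <;> lia

/-- The coloring of a satisfying assignment is a clique coloring. -/
theorem not_mono_of_maximal (h₀ : st 0 = false)
    (hst : ∀ j : Fin m, st (j + 1) = nextState asg (st j) (tok j))
    (hend : ∀ j : Fin m, tok j = none → st j = true) (hX : Maximal (graph tok).IsClique X) :
    ¬ ∀ u ∈ X, ∀ v ∈ X, color tok asg st u = color tok asg st v := by
  intro hmono
  have hpos : ∀ u ∈ X, ∃ k, pos u = some k := by
    intro u hu
    cases u with
    | x i => exact absurd hu (x_notMem hX hmono i)
    | P => exact absurd hu (P_notMem hX hmono)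
    | Q => exact absurd hu (Q_notMem hX hmono)
    | T => exact absurd hu (T_notMem hX hmono)
    | F => exact absurd hu (F_notMem hX hmono)
    | _ => simp [pos]
  -- There are no isolated vertices, so a maximal clique is not a singleton; it is nonempty because
  -- the graph is.
  have hex : ∃ u ∈ X, ∃ v ∈ X, u ≠ v := by
    by_contra hne
    push Not at hne
    obtain ⟨u, hu⟩ : X.Nonempty := by
      by_contra hemp
      rw [Set.not_nonempty_iff_eq_empty] at hemp
      have := SimpleGraph.mem_of_maximal_isClique hX (w := .P) (by simp [hemp])
      simp [hemp] at this
    obtain ⟨v, hv⟩ := exists_neighbor (tok := tok) u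
    have hvX := SimpleGraph.mem_of_maximal_isClique hX (w := v)
      fun y hy _ => (hne u hu y hy) ▸ hv
    exact hv.ne (hne u hu v hvX)
  have hpair : ∃ u ∈ X, ∃ v ∈ X, ∃ k, pos u = some k ∧ pos v = some (k + 1) := by
    obtain ⟨u, hu, v, hv, hne⟩ := hex
    obtain ⟨k, hk⟩ := hpos u hu
    obtain ⟨l, hl⟩ := hpos v hv
    rcases pos_succ_of_adj hk hl (hX.1 hu hv hne) with rfl | rfl
    · exact ⟨u, hu, v, hv, k, hk, hl⟩
    · exact ⟨v, hv, u, hu, l, hl, hk⟩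
  obtain ⟨u, hu, v, hv, k, hk, hl⟩ := hpair
  have hne : u ≠ v := by
    rintro rfl
    simp [hk] at hl
  obtain ⟨j, a, a', i, b, rfl, rfl, ha, hj, -, hp, hp', -⟩ :=
    color_chain h₀ hst hend hk hl rfl (hX.1 hu hv hne) (hmono _ hu _ hv)
  -- A third vertex would have to be consecutive on the path to both members of the pair. Hence the
  -- clique is just the pair, and `T` or `F` can be added to it.
  have key : ∀ y ∈ X, y = .blk j a ∨ y = .blk j a' := by
    intro y hy
    by_contra hyn
    rw [not_or] at hyn
    obtain ⟨l, hy'⟩ := hpos y hy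
    have h₁ := pos_succ_of_adj hy' hk (hX.1 hy hu hyn.1)
    have h₂ := pos_succ_of_adj hy' hl (hX.1 hy hv hyn.2)
    lia
  cases b
  · refine F_notMem hX hmono (SimpleGraph.mem_of_maximal_isClique hX fun y hy _ => ?_)
    rcases key y hy with rfl | rfl <;> simp [adj_iff, link, hj, onF, hp, hp']
  · refine T_notMem hX hmono (SimpleGraph.mem_of_maximal_isClique hX fun y hy _ => ?_)
    rcases key y hy with rfl | rfl <;> simp [adj_iff, link, hj, onT, hp, hp']

end Complete

end SatGraph

/-! ### Colorability of the graph is satisfiability of the formula -/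

namespace SatGraph

open StackProg (tokens)

variable {n : ℕ}

/-- The graph of the reduction for a list of clauses. -/
def clauseGraph (cs : List (List (Fin n × Bool))) : SimpleGraph (Vert n (tokens cs).length) :=
  graph fun j => (tokens cs)[j]

theorem tokens_append (cs ds : List (List (Fin n × Bool))) :
    tokens (cs ++ ds) = tokens cs ++ tokens ds := by
  simp [tokens]

theorem tokens_cons (C : List (Fin n × Bool)) (cs : List (List (Fin n × Bool))) :
    tokens (C :: cs) = C.map some ++ none :: tokens cs := by
  simp [tokens]

theorem tokens_last (cs : List (List (Fin n × Bool))) (h : (tokens cs).length ≠ 0) :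
    (tokens cs)[(tokens cs).length - 1] = none := by
  rcases List.eq_nil_or_concat cs with rfl | ⟨ds, D, rfl⟩
  · simp [tokens] at h
  · simp [tokens]

/-- If no literal of the clause were true, the color of `T` would be passed on from block to block
by `color_lit` and reach the clause end, where `color_end` forbids it. -/
theorem exists_true_literal {cs : List (List (Fin n × Bool))}
    {f : Vert n (tokens cs).length → Fin 2} (hf : (clauseGraph cs).IsCliqueColoring f)
    {C : List (Fin n × Bool)} (hC : C ∈ cs) : ∃ l ∈ C, f (.x l.1) = f .T ↔ l.2 = true := by
  by_contra hne
  have hne' : ∀ l ∈ C, ¬ (f (.x l.1) = f .T ↔ l.2 = true) := fun l hl h => hne ⟨l, hl, h⟩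
  obtain ⟨ds, es, rfl⟩ := List.append_of_mem hC
  have htok : tokens (ds ++ C :: es) = tokens ds ++ (C.map some ++ none :: tokens es) := by
    rw [tokens_append, tokens_cons]
  have hlen : (tokens (ds ++ C :: es)).length =
      (tokens ds).length + (C.length + ((tokens es).length + 1)) := by
    rw [htok]
    simp
  have claim : ∀ d (hd : d ≤ C.length), f (prev ⟨(tokens ds).length + d, by lia⟩) = f .T := by
    intro d
    induction d with
    | zero =>
      intro _
      -- The first clause starts after `S`, any other one after a clause end; both have the color of
      -- `T`.
      by_cases h : (tokens ds).length = 0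
      · rw [prev_zero (by simpa using h)]
        exact color_S hf
      · rw [prev_succ (j := ⟨(tokens ds).length - 1, by lia⟩) (by simp; lia)]
        refine (color_end hf ?_).2
        have := tokens_last ds h
        simp only [Fin.getElem_fin, htok]
        rw [List.getElem_append_left (by lia), this]
    | succ d ih =>
      intro hd
      rw [prev_succ (j := ⟨(tokens ds).length + d, by lia⟩) (by simp; lia)]
      refine color_lit hf (i := (C[d]).1) (b := (C[d]).2) ?_ (hne' _ (List.getElem_mem _))
        (ih (by lia))
      simp only [Fin.getElem_fin, htok]
      rw [List.getElem_append_right (by lia), List.getElem_append_left (by simp; lia)]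
      simp
  refine (color_end hf (j := ⟨(tokens ds).length + C.length, by lia⟩) ?_).1 (claim _ le_rfl)
  simp only [Fin.getElem_fin, htok]
  rw [List.getElem_append_right (by lia), List.getElem_append_right (by simp)]
  simp

theorem foldl_nextState_map (asg : Fin n → Bool) (s : Bool) (C : List (Fin n × Bool)) :
    (C.map some).foldl (nextState asg) s = (s || C.any fun l => decide (asg l.1 = l.2)) := by
  induction C generalizing s with
  | nil => simp
  | cons l C ih => simp [ih, nextState, Bool.or_assoc]

/-- Each clause end resets the state to `false`, so the induction over clauses starts afresh after
each of them. A prefix followed by a clause end cannot stop inside the literals of a clause. -/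
theorem foldl_nextState_of_end {asg : Fin n → Bool} {cs : List (List (Fin n × Bool))}
    (h : ∀ C ∈ cs, ∃ l ∈ C, asg l.1 = l.2) {p rest : List (Option (Fin n × Bool))}
    (hp : tokens cs = p ++ none :: rest) : p.foldl (nextState asg) false = true := by
  induction cs generalizing p with
  | nil => simp [tokens] at hp
  | cons C cs ih =>
    have hC : (C.map some).foldl (nextState asg) false = true := by
      rw [foldl_nextState_map]
      simpa using h C (by simp)
    rw [tokens_cons, List.append_eq_append_iff] at hp
    rcases hp with ⟨q, rfl, hq⟩ | ⟨q, hCq, hq⟩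
    · rcases q with _ | ⟨t, q⟩
      · simpa using hC
      · simp only [List.cons_append, List.cons.injEq] at hq
        obtain ⟨rfl, hq⟩ := hq
        rw [List.foldl_append, List.foldl_cons]
        exact ih (fun D hD => h D (by simp [hD])) hq
    · rcases q with _ | ⟨t, q⟩
      · rw [List.append_nil] at hCq
        rwa [← hCq]
      · simp only [List.cons_append, List.cons.injEq] at hq
        obtain ⟨rfl, -⟩ := hq
        have : none ∈ C.map some := by
          rw [hCq]
          simp
        simp at this

/-- The graph of the reduction is 2-clique-colorable if and only if the formula is satisfiable. -/
theorem cliqueColorable_clauseGraph_iff (cs : List (List (Fin n × Bool))) :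
    (clauseGraph cs).CliqueColorable 2 ↔
      ∃ asg : Fin n → Bool, ∀ C ∈ cs, ∃ l ∈ C, asg l.1 = l.2 := by
  constructor
  · rintro ⟨f, hf⟩
    refine ⟨fun i => decide (f (.x i) = f .T), fun C hC => ?_⟩
    obtain ⟨l, hl, h⟩ := exists_true_literal hf hC
    refine ⟨l, hl, ?_⟩
    rw [Bool.eq_iff_iff]
    simpa using h
  · rintro ⟨asg, hasg⟩
    let st : ℕ → Bool := fun j => ((tokens cs).take j).foldl (nextState asg) false
    refine ⟨fun v => if color (fun j => (tokens cs)[j]) asg st v then 1 else 0, fun X hX => ?_⟩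
    rintro ⟨i, hi⟩
    refine not_mono_of_maximal (asg := asg) (st := st) (by simp [st]) ?_ ?_ hX ?_
    · intro j
      simp only [st]
      rw [List.take_add_one, List.foldl_append, List.getElem?_eq_getElem j.2]
      rfl
    · intro j hj
      refine foldl_nextState_of_end hasg (rest := (tokens cs).drop (j + 1)) ?_
      rw [← hj]
      simp
    · intro u hu v hv
      have hinj : ∀ b b' : Bool, (if b = true then (1 : Fin 2) else 0) =
          (if b' = true then 1 else 0) → b = b' := by decide
      exact hinj _ _ ((hi u hu).trans (hi v hv).symm)

end SatGraph

namespace SatGraph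

open StackProg

variable {n m : ℕ}

/-! ### The adjacency matrix -/

/-- The vertices in the order of the adjacency matrix. -/
def verts (n m : ℕ) : List (Vert n m) :=
  (List.finRange n).map .x ++ [.P, .Q, .T, .F, .R, .S] ++
    (List.finRange m).flatMap (fun j => [.blk j 0, .blk j 1, .blk j 2, .blk j 3]) ++ [.z]

theorem length_verts : (verts n m).length = n + 7 + 4 * m := by
  simp [verts, List.length_flatMap]
  lia

theorem mem_verts (v : Vert n m) : v ∈ verts n m := by
  cases v with
  | blk j a =>
    fin_cases a <;> simp [verts]
  | _ => simp [verts]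

theorem nodup_verts : (verts n m).Nodup := by
  have h₁ : ((List.finRange n).map (Vert.x : Fin n → Vert n m)).Nodup :=
    (List.nodup_finRange n).map fun i j h => by simpa using h
  have h₂ : ((List.finRange m).flatMap
      (fun j => [(.blk j 0 : Vert n m), .blk j 1, .blk j 2, .blk j 3])).Nodup := by
    rw [List.nodup_flatMap]
    refine ⟨fun j _ => by simp, (List.nodup_finRange m).imp fun {j j'} h => ?_⟩
    simp [Function.onFun, List.disjoint_left, h]
  simp [verts, List.nodup_append, h₁, h₂]
  try lia

/-- The graph of the reduction, on the vertices `0, …, n + 6 + 4 * m`. -/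
def finGraph (cs : List (List (Fin n × Bool))) : FinGraph where
  numVerts := (verts n (tokens cs).length).length
  graph := (clauseGraph cs).comap (verts n (tokens cs).length).get

/-- The bits of the adjacency matrix. -/
def bit (tok : Fin m → Option (Fin n × Bool)) (u v : Vert n m) : Bool :=
  link tok u v || link tok v u

theorem encode_finGraph (cs : List (List (Fin n × Bool))) :
    (finGraph cs).encode = encodeUnary (n + 7 + 4 * (tokens cs).length) ++
      (verts n (tokens cs).length).flatMap fun u =>
        (verts n (tokens cs).length).map (bit (fun j => (tokens cs)[j]) u) := by
  simp only [FinGraph.encode]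
  congr 1
  · simp [finGraph, length_verts]
  · let l := verts n (tokens cs).length
    have h₁ : ∀ i j : Fin l.length, @decide (((clauseGraph cs).comap l.get).Adj i j)
        (Classical.propDecidable _) =
          bit (fun j => (tokens cs)[j]) (l.get i) (l.get j) := by
      intro i j
      rw [Bool.eq_iff_iff, @decide_eq_true_iff _ (Classical.propDecidable _)]
      rfl
    have h₂ : ∀ u, (List.finRange l.length).map (fun j => bit (fun j => (tokens cs)[j]) u (l.get j))
        = l.map (bit (fun j => (tokens cs)[j]) u) := by
      intro u
      conv_rhs => rw [← List.map_get_finRange l, List.map_map]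
      rfl
    have h₃ : l.flatMap (fun u => l.map (bit (fun j => (tokens cs)[j]) u)) =
        (List.finRange l.length).flatMap
          (fun i => l.map (bit (fun j => (tokens cs)[j]) (l.get i))) := by
      conv_lhs => rw [← List.map_get_finRange l, List.flatMap_map, List.map_get_finRange l]
    change (List.finRange l.length).flatMap (fun i => (List.finRange l.length).map fun j =>
      @decide (((clauseGraph cs).comap l.get).Adj i j) (Classical.propDecidable _)) = _
    simp only [h₁, h₂]
    exact h₃.symm

/-! ### The rows of the matrix -/

theorem map_verts (g : Vert n m → Bool) :
    (verts n m).map g = (List.finRange n).map (fun i => g (.x i)) ++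
      [g .P, g .Q, g .T, g .F, g .R] ++ (g .S :: ((List.finRange m).flatMap
        (fun j => [g (.blk j 0), g (.blk j 1), g (.blk j 2), g (.blk j 3)]) ++ [g .z])) := by
  simp [verts, List.map_flatMap, Function.comp_def]

theorem flatMap_range_four (f : ℕ → Bool) (m : ℕ) :
    (List.range m).flatMap (fun j => [f (4 * j), f (4 * j + 1), f (4 * j + 2), f (4 * j + 3)]) =
      (List.range (4 * m)).map f := by
  induction m with
  | zero => rfl
  | succ m ih =>
    rw [List.range_succ, List.flatMap_append, ih, Nat.mul_succ]
    simp [List.range_succ]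

theorem flatMap_finRange {α : Type*} (m : ℕ) (f : ℕ → List α) :
    (List.finRange m).flatMap (fun j : Fin m => f (j : ℕ)) = (List.range m).flatMap f := by
  rw [← List.map_coe_finRange_eq_range, List.flatMap_map]

/-- The part of a row that belongs to the path. -/
theorem chain_row (g : Vert n m → Bool) (f : ℕ → Bool) (hS : g .S = f 0)
    (hblk : ∀ (j : Fin m) (a : Fin 4), g (.blk j a) = f (4 * j + a + 1))
    (hz : g .z = f (4 * m + 1)) :
    g .S :: ((List.finRange m).flatMap
      (fun j => [g (.blk j 0), g (.blk j 1), g (.blk j 2), g (.blk j 3)]) ++ [g .z]) =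
      (List.range (4 * m + 2)).map f := by
  have h := flatMap_range_four (fun k => f (k + 1)) m
  rw [← flatMap_finRange m fun j =>
    [f (4 * j + 1), f (4 * j + 1 + 1), f (4 * j + 2 + 1), f (4 * j + 3 + 1)]] at h
  rw [List.range_succ_eq_map, List.range_succ]
  simp only [hblk, hS, hz, List.map_cons, List.map_append, List.map_map, List.map_nil,
    Function.comp_def]
  rw [← h]
  rfl

theorem map_range_eq_replicate {f : ℕ → Bool} {k : ℕ} (h : ∀ i < k, f i = false) :
    (List.range k).map f = List.replicate k false := by
  rw [List.eq_replicate_iff]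
  refine ⟨by simp, fun b hb => ?_⟩
  simp only [List.mem_map, List.mem_range] at hb
  obtain ⟨i, hi, rfl⟩ := hb
  exact h i hi

theorem flatten_zeros (k : ℕ) : (List.replicate k zeros).flatten = List.replicate (4 * k) false := by
  rw [mul_comm]
  exact flatten_replicate_replicate k 4 false

theorem hot_eq {v : ℕ} (hv : v < n) :
    hot n v = (List.range n).map fun k => decide (v = k) := by
  obtain ⟨k, rfl⟩ : ∃ k, n = v + (k + 1) := ⟨n - v - 1, by lia⟩
  rw [List.range_add, List.range_succ_eq_map, List.map_append,
    map_range_eq_replicate (by simp; lia)]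
  simp only [List.map_cons, List.map_map, Function.comp_def]
  rw [map_range_eq_replicate (by simp)]
  simp [hot]

variable (tok : Fin m → Option (Fin n × Bool))

theorem map_var_blk (j : Fin m) (a : Fin 4) :
    (List.finRange n).map (fun i => bit tok (.blk j a) (.x i)) =
      match tok j with
      | none => List.replicate n false
      | some (i, b) => if inPair b a then hot n i else List.replicate n false := by
  rcases hj : tok j with _ | ⟨i, b⟩
  · simp [bit, link, pos, hj, onX]
  · cases hp : inPair b a
    · simp [bit, link, pos, hj, onX, hp]
    · simp [bit, link, pos, hj, onX, hp, hot_eq i.2, ← List.map_coe_finRange_eq_range, Fin.ext_iff]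

/-- The marks on the path in the row of a vertex of a block. -/
def chainBit (tok : Fin m → Option (Fin n × Bool)) (j : Fin m) (a : Fin 4) (k : ℕ) : Bool :=
  (decide (k = 4 * j + a + 2) && !((tok j).isNone && decide (a = 1))) ||
  (decide (4 * (j : ℕ) + a = k) && !((tok j).isNone && decide (a = 2)))

/-- The gap is recorded at the lower end of the missing edge, possibly in terms of another token.
But a predecessor with index 1 lies in the same block as its successor with index 2, so the row
depends on the token of its own block only. The argument of `chainBit` is the position counted from
`S`. -/
theorem bit_blk_blk (j j' : Fin m) (a a' : Fin 4) :
    bit tok (.blk j a) (.blk j' a') = chainBit tok j a (4 * j' + a' + 1) := by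
  rw [Bool.eq_iff_iff]
  change (graph tok).Adj _ _ ↔ _
  rw [adj_blk_blk]
  simp only [chainBit, Bool.or_eq_true, Bool.and_eq_true, decide_eq_true_eq, Bool.not_eq_true',
    Bool.and_eq_false_iff, Option.isNone_eq_false_iff, Option.isSome_iff_ne_none,
    decide_eq_false_iff_not, ← not_and_or]
  refine or_congr (and_congr (by lia) Iff.rfl) (and_congr_right fun h => not_congr ?_)
  by_cases hj : j' = j
  · subst hj
    have : a' = 1 ↔ a = 2 := by
      rw [Fin.ext_iff, Fin.ext_iff]
      simp
      lia
    rw [this]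
  · have : (j' : ℕ) ≠ j := fun h => hj (Fin.ext h)
    have h₁ : a' ≠ 1 := fun h => by subst h; simp at *; lia
    have h₂ : a ≠ 2 := fun h => by subst h; simp at *; lia
    simp [h₁, h₂]

/-- With positions counted from `S`, the neighbors on the path of a vertex of block `j` lie among
the six positions from `4 * j`: the vertex before the block, the block and the vertex after it.
Thanks to `S` and `z` this also holds for the first and the last block. -/
theorem chain_row_blk (j : Fin m) (a : Fin 4) :
    bit tok (.blk j a) .S :: ((List.finRange m).flatMap (fun j' =>
      [bit tok (.blk j a) (.blk j' 0), bit tok (.blk j a) (.blk j' 1),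
        bit tok (.blk j a) (.blk j' 2), bit tok (.blk j a) (.blk j' 3)]) ++
        [bit tok (.blk j a) .z]) =
    (List.replicate j zeros).flatten ++
      (List.range 6).map (fun k => chainBit tok j a (4 * j + k)) ++
      (List.replicate (m - 1 - j) zeros).flatten := by
  rw [chain_row (bit tok (.blk j a)) (chainBit tok j a)]
  · have : 4 * m + 2 = 4 * j + (6 + 4 * (m - 1 - j)) := by lia
    rw [this, List.range_add, List.range_add, flatten_zeros, flatten_zeros]
    simp only [List.map_append, List.map_map, Function.comp_def, List.append_assoc]
    have h₁ : ∀ k < 4 * (j : ℕ), chainBit tok j a k = false := by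
      intro k hk
      have e₁ : k ≠ 4 * j + a + 2 := by lia
      have e₂ : 4 * (j : ℕ) + a ≠ k := by lia
      simp [chainBit, e₁, e₂]
    have h₂ : ∀ k < 4 * (m - 1 - (j : ℕ)), chainBit tok j a (4 * j + (6 + k)) = false := by
      intro k hk
      have e₁ : 4 * (j : ℕ) + (6 + k) ≠ 4 * j + a + 2 := by lia
      have e₂ : (a : ℕ) ≠ 6 + k := by lia
      simp [chainBit, e₁, e₂]
    rw [map_range_eq_replicate h₁, map_range_eq_replicate h₂]
  · rw [Bool.eq_iff_iff]
    by_cases ha : 4 * (j : ℕ) + a = 0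
    · have h₁ : a ≠ 2 := fun h => by subst h; simp at ha
      have h₂ : a = 0 := Fin.ext (by simp; lia)
      have h₃ : (j : ℕ) = 0 := by lia
      simp [bit, link, pos, chainBit, h₃, h₂]
    · simp [bit, link, pos, chainBit]
      lia
  · intro j' a'
    exact bit_blk_blk tok j j' a a'
  · have h : 4 * (j : ℕ) + a ≠ 4 * m + 1 := by lia
    simp [bit, link, pos, chainBit, broken, h]

theorem flatMap_finRange_get {α β : Type*} (l : List α) (f : α → List β) :
    (List.finRange l.length).flatMap (fun j => f l[j]) = l.flatMap f := by
  conv_rhs => rw [← List.map_get_finRange l, List.flatMap_map]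
  rfl

theorem row_var (toks : List (Option (Fin n × Bool))) (i : Fin n) :
    (verts n toks.length).map (bit (fun j => toks[j]) (.x i)) = varRowBits toks i := by
  have h := flatMap_finRange_get toks (varBits i)
  rw [map_verts, varRowBits, ← h]
  have h' : ∀ j : Fin toks.length, [bit (fun j => toks[j]) (.x i) (.blk j 0),
      bit (fun j => toks[j]) (.x i) (.blk j 1), bit (fun j => toks[j]) (.x i) (.blk j 2),
      bit (fun j => toks[j]) (.x i) (.blk j 3)] = varBits i toks[j] := by
    intro j
    simp only [bit, link]
    rcases toks[j] with _ | ⟨i', b⟩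
    · simp [onX, varBits, zeros, pos]
    · by_cases hi : i' = i
      · simp [onX, varBits, pairBits, pos, hi, inPair]
      · simp [onX, varBits, zeros, pos, hi, Fin.val_inj]
  simp only [h']
  simp [bit, link, List.map_const', pos]

theorem row_blk (toks : List (Option (Fin n × Bool))) (j : Fin toks.length) :
    [(.blk j 0 : Vert n toks.length), .blk j 1, .blk j 2, .blk j 3].flatMap
      (fun u => (verts n toks.length).map (bit (fun j => toks[j]) u)) =
        blockBits j (toks.length - 1 - j) (toks[(j : ℕ)]?.getD none) := by
  have h : ∀ a : Fin 4, (verts n toks.length).map (bit (fun j => toks[j]) (.blk j a)) = _ :=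
    fun a => by rw [map_verts, chain_row_blk, map_var_blk]
  simp only [List.flatMap_cons, List.flatMap_nil, h, List.getElem?_eq_getElem j.2,
    Option.getD_some, blockBits]
  simp only [bit, link, chainBit, Fin.getElem_fin]
  rcases toks[(j : ℕ)] with _ | ⟨i, b⟩
  · simp [blockTable, blockRowBits, onT, onF, pos, List.range_succ]
    lia
  · cases b <;> simp [blockTable, blockRowBits, onT, onF, pos, inPair, List.range_succ] <;> lia

/-- The row of a vertex that is adjacent to no block. -/
theorem row_of_blocks_zero (g : Vert n m → Bool) (h : ∀ j a, g (.blk j a) = false) :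
    (verts n m).map g = (List.finRange n).map (fun i => g (.x i)) ++
      [g .P, g .Q, g .T, g .F, g .R, g .S] ++ (List.replicate m zeros).flatten ++ [g .z] := by
  rw [map_verts]
  simp [h, zeros, List.flatMap, List.map_const']

/-- The successor of `S` on the path follows it directly in the order of the matrix, whether it is a
block vertex or, without tokens, `z`. So the same bits serve both cases. -/
theorem row_S : (verts n m).map (bit tok .S) =
    List.replicate n false ++ [false, true, false, true, true, false, true] ++
      (List.replicate m zeros).flatten := by
  rw [map_verts, chain_row (bit tok .S) fun k => decide (k = 1)]
  · rw [flatten_zeros, Nat.add_comm, List.range_add, List.map_append, List.map_map,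
      map_range_eq_replicate (k := 4 * m) (by simp; lia)]
    simp [bit, link, List.map_const', List.range_succ, pos]
  · simp [bit, link, pos]
  · intro j a
    simp [bit, link, pos]
  · simp [bit, link, pos]

theorem row_z : (verts n m).map (bit tok .z) =
    List.replicate n false ++ [false, false, false, false, false] ++
      (List.replicate m zeros).flatten ++ [true, false] := by
  rw [map_verts, chain_row (bit tok .z) fun k => decide (k = 4 * m)]
  · rw [flatten_zeros, List.range_add, List.map_append, map_range_eq_replicate (by simp; lia)]
    simp [bit, link, List.map_const', List.range_succ]
  · simp [bit, link, pos]
  · intro j a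
    have h : 4 * m + 2 = 4 * (j : ℕ) + a + 3 ↔ 4 * (j : ℕ) + a + 1 = 4 * m := by lia
    have h' : 4 * (j : ℕ) + a + 1 = 4 * m → a ≠ 1 := by
      rintro h rfl
      simp at h
      lia
    rw [Bool.eq_iff_iff]
    simp [bit, link, pos, broken]
    tauto
  · simp [bit, link]

theorem row_T (toks : List (Option (Fin n × Bool))) :
    (verts n toks.length).map (bit (fun j => toks[j]) .T) =
      List.replicate n false ++ [false, false, false, false, true, false] ++
      toks.flatMap (fun t => (t.map Prod.snd).elim [false, true, false, false]
        fun b => cond b (pairBits true) zeros) ++ [false] := by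
  rw [map_verts, ← flatMap_finRange_get toks]
  have h : ∀ j : Fin toks.length, [bit (fun j => toks[j]) .T (.blk j 0),
      bit (fun j => toks[j]) .T (.blk j 1), bit (fun j => toks[j]) .T (.blk j 2),
      bit (fun j => toks[j]) .T (.blk j 3)] = ((toks[j]).map Prod.snd).elim
        [false, true, false, false] fun b => cond b (pairBits true) zeros := by
    intro j
    simp only [bit, link]
    rcases toks[j] with _ | ⟨i, _ | _⟩ <;> simp [onT, pos, pairBits, zeros, inPair]
  simp only [h]
  simp [bit, link, List.map_const', pos]

theorem row_F (toks : List (Option (Fin n × Bool))) :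
    (verts n toks.length).map (bit (fun j => toks[j]) .F) =
      List.replicate n false ++ [false, false, false, false, false, true] ++
      toks.flatMap (fun t => (t.map Prod.snd).elim [false, false, false, true]
        fun b => cond b zeros (pairBits false)) ++ [false] := by
  rw [map_verts, ← flatMap_finRange_get toks]
  have h : ∀ j : Fin toks.length, [bit (fun j => toks[j]) .F (.blk j 0),
      bit (fun j => toks[j]) .F (.blk j 1), bit (fun j => toks[j]) .F (.blk j 2),
      bit (fun j => toks[j]) .F (.blk j 3)] = ((toks[j]).map Prod.snd).elim
        [false, false, false, true] fun b => cond b zeros (pairBits false) := by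
    intro j
    simp only [bit, link]
    rcases toks[j] with _ | ⟨i, _ | _⟩ <;> simp [onF, pos, pairBits, zeros, inPair]
  simp only [h]
  simp [bit, link, List.map_const', pos]

theorem matrix_eq (toks : List (Option (Fin n × Bool))) :
    ((verts n toks.length).flatMap fun u => (verts n toks.length).map
      (bit (fun j => toks[j]) u)) = matrixBits toks := by
  have hx := flatMap_finRange n (varRowBits toks)
  have hb := flatMap_finRange toks.length fun j =>
    blockBits j (toks.length - 1 - j) (toks[j]?.getD none)
  simp only [← row_var, ← row_blk] at hx hb
  have hP := row_of_blocks_zero (bit (fun j => toks[j]) .P)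
    fun j a => by simp [bit, link, pos]
  have hQ := row_of_blocks_zero (bit (fun j => toks[j]) .Q)
    fun j a => by simp [bit, link, pos]
  have hR := row_of_blocks_zero (bit (fun j => toks[j]) .R)
    fun j a => by simp [bit, link, pos]
  rw [matrixBits, allBlockBits, ← hx, ← hb, ← row_T, ← row_F,
    ← row_S fun j : Fin toks.length => toks[j], ← row_z fun j : Fin toks.length => toks[j]]
  have hP' : (List.finRange n).map (fun i => bit (fun j => toks[j]) .P (.x i)) =
      List.replicate n true := by simp [bit, link, List.map_const']
  have hQ' : (List.finRange n).map (fun i => bit (fun j => toks[j]) .Q (.x i)) =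
      List.replicate n true := by simp [bit, link, List.map_const']
  have hR' : (List.finRange n).map (fun i => bit (fun j => toks[j]) .R (.x i)) =
      List.replicate n false := by simp [bit, link, List.map_const']
  rw [hP'] at hP
  rw [hQ'] at hQ
  rw [hR'] at hR
  have eP : ([bit (fun j => toks[j]) .P .P, bit (fun j => toks[j]) .P .Q,
    bit (fun j => toks[j]) .P .T, bit (fun j => toks[j]) .P .F, bit (fun j => toks[j]) .P .R,
    bit (fun j => toks[j]) .P .S], bit (fun j => toks[j]) .P .z) =
    ([false, true, false, false, true, false], false) := by simp [bit, link, pos]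
  have eQ : ([bit (fun j => toks[j]) .Q .P, bit (fun j => toks[j]) .Q .Q,
    bit (fun j => toks[j]) .Q .T, bit (fun j => toks[j]) .Q .F, bit (fun j => toks[j]) .Q .R,
    bit (fun j => toks[j]) .Q .S], bit (fun j => toks[j]) .Q .z) =
    ([true, false, false, false, false, true], false) := by simp [bit, link, pos]
  have eR : ([bit (fun j => toks[j]) .R .P, bit (fun j => toks[j]) .R .Q,
    bit (fun j => toks[j]) .R .T, bit (fun j => toks[j]) .R .F, bit (fun j => toks[j]) .R .R,
    bit (fun j => toks[j]) .R .S], bit (fun j => toks[j]) .R .z) =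
    ([true, false, true, false, false, true], false) := by simp [bit, link, pos]
  rw [Prod.mk.injEq] at eP eQ eR
  rw [eP.1, eP.2] at hP
  rw [eQ.1, eQ.2] at hQ
  rw [eR.1, eR.2] at hR
  rw [← hP, ← hQ, ← hR]
  conv_lhs => enter [2]; rw [verts]
  simp only [List.flatMap_append, List.flatMap_map, List.flatMap_assoc, List.flatMap_cons,
    List.flatMap_nil, List.append_nil, List.append_assoc]

end SatGraph

namespace SimpleGraph

variable {V : Type*}

/-! ### Graphs that are close to a path -/

/-- The vertices outside of `D` lie on a path: they have distinct ranks, and the ranks of adjacent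
vertices are consecutive. -/
structure IsPathOutside (G : SimpleGraph V) (D : Finset V) (r : V → ℕ) : Prop where
  injOn : ∀ u v, u ∉ D → v ∉ D → r u = r v → u = v
  adj : ∀ u v, u ∉ D → v ∉ D → G.Adj u v → r v = r u + 1 ∨ r u = r v + 1

variable {G : SimpleGraph V} {D : Finset V} {r : V → ℕ}

/-- At a vertex of maximal rank on a cycle, both neighbors along the cycle have rank one less and
therefore coincide. -/
theorem IsPathOutside.isAcyclic (h : G.IsPathOutside D r) : (G.induce {v | v ∉ D}).IsAcyclic := by
  intro v c hc
  classical
  obtain ⟨u, hu, hmax⟩ := c.support.toFinset.exists_max_image (fun w => r w.1) ⟨v, by simp⟩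
  rw [List.mem_toFinset] at hu
  have hc' := hc.rotate hu
  have hlow : ∀ w ∈ (c.rotate u hu).support, (G.induce {v | v ∉ D}).Adj u w → r u.1 = r w.1 + 1 := by
    intro w hw huw
    have h₁ := hmax w (by simpa using hw)
    have h₂ := h.adj u.1 w.1 u.2 w.2 huw
    lia
  have h₁ := hlow _ ((c.rotate u hu).getVert_mem_support _) (Walk.adj_snd hc'.not_nil)
  have h₂ := hlow _ ((c.rotate u hu).getVert_mem_support _)
    (Walk.adj_penultimate hc'.not_nil).symm
  exact hc'.snd_ne_penultimate (Subtype.ext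
    (h.injOn _ _ (c.rotate u hu).snd.2 (c.rotate u hu).penultimate.2 (by lia)))

theorem IsPathOutside.isLinearForest (h : G.IsPathOutside D r) :
    (G.induce {v | v ∉ D}).IsLinearForest := by
  refine ⟨h.isAcyclic, fun v => ?_⟩
  have hsub : (fun w : {v | v ∉ D} => r w.1) '' ((G.induce {v | v ∉ D}).neighborSet v) ⊆
      {r v.1 + 1, r v.1 - 1} := by
    rintro _ ⟨w, hw, rfl⟩
    have := h.adj v.1 w.1 v.2 w.2 hw
    simp
    lia
  have hinj : Set.InjOn (fun w : {v | v ∉ D} => r w.1) ((G.induce {v | v ∉ D}).neighborSet v) :=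
    fun w _ w' _ hw => Subtype.ext (h.injOn _ _ w.2 w'.2 hw)
  rw [← hinj.encard_image]
  exact (Set.encard_le_encard hsub).trans ((Set.encard_insert_le _ _).trans
    (by norm_num [Set.encard_singleton]))

theorem IsPathOutside.distToLinearForest_le (h : G.IsPathOutside D r) :
    G.distToLinearForest ≤ D.card :=
  Nat.sInf_le ⟨D, rfl, h.isLinearForest⟩

theorem IsPathOutside.feedbackVertexSetNumber_le (h : G.IsPathOutside D r) :
    G.feedbackVertexSetNumber ≤ D.card :=
  Nat.sInf_le ⟨D, rfl, h.isAcyclic⟩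

/-- The bag `i` consists of `D` and the at most two vertices outside `D` of rank `i` or `i + 1`. -/
theorem IsPathOutside.exists_isPathDecomposition [Fintype V] (h : G.IsPathOutside D r) :
    ∃ (m : ℕ) (B : Fin m → Finset V), G.IsPathDecomposition B ∧
      ∀ i, (B i).card ≤ D.card + 1 + 1 := by
  classical
  obtain ⟨N, hN⟩ : ∃ N, ∀ v, r v < N :=
    ⟨Finset.univ.sup r + 1, fun v => Nat.lt_succ_of_le (Finset.le_sup (Finset.mem_univ v))⟩
  refine ⟨N + 1, fun i => D ∪ Finset.univ.filter fun v => v ∉ D ∧ (r v = i ∨ r v = i + 1),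
    ⟨fun v => ⟨⟨r v, (hN v).trans (Nat.lt_succ_self N)⟩, ?_⟩, ?_, ?_⟩, fun i => ?_⟩
  · by_cases hv : v ∈ D <;> simp [hv]
  · have key : ∀ u v, G.Adj u v → (u ∉ D → v ∉ D → r v = r u + 1) →
        ∃ k < N + 1, (u ∈ D ∨ u ∉ D ∧ (r u = k ∨ r u = k + 1)) ∧
          (v ∈ D ∨ v ∉ D ∧ (r v = k ∨ r v = k + 1)) := by
      intro u v _ hr
      by_cases hu : u ∈ D
      · exact ⟨r v, by have := hN v; lia, by simp [hu], by tauto⟩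
      · refine ⟨r u, by have := hN u; lia, by simp [hu], by tauto⟩
    intro u v huv
    by_cases hr : u ∉ D → v ∉ D → r v = r u + 1
    · obtain ⟨k, hk, h₁⟩ := key u v huv hr
      exact ⟨⟨k, hk⟩, by simpa using h₁⟩
    · have := h.adj u v
      obtain ⟨k, hk, h₁⟩ := key v u huv.symm (by tauto)
      exact ⟨⟨k, hk⟩, by simpa using h₁.symm⟩
  · intro v i j k hij hjk
    have hij' : (i : ℕ) ≤ j := hij
    have hjk' : (j : ℕ) ≤ k := hjk
    simp
    by_cases hv : v ∈ D
    · simp [hv]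
    · simp [hv]
      lia
  · refine (Finset.card_union_le _ _).trans ?_
    rw [add_assoc]
    refine Nat.add_le_add_left ?_ _
    have : (Finset.univ.filter fun v => v ∉ D ∧ (r v = i ∨ r v = i + 1)).card ≤
        ({(i : ℕ), (i : ℕ) + 1} : Finset ℕ).card := by
      refine Finset.card_le_card_of_injOn r (fun v hv => ?_) fun u hu v hv huv => ?_
      · simp at hv ⊢
        exact hv.2
      · simp at hu hv
        exact h.injOn u v hu.1 hv.1 huv
    simpa using this

theorem IsPathOutside.pathwidth_le [Fintype V] (h : G.IsPathOutside D r) :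
    G.pathwidth ≤ D.card + 1 :=
  Nat.sInf_le h.exists_isPathDecomposition

theorem CliqueColorable.of_iso {V W : Type*} {G : SimpleGraph V} {H : SimpleGraph W} {q : ℕ}
    (e : G ≃g H) (h : H.CliqueColorable q) : G.CliqueColorable q := by
  obtain ⟨f, hf⟩ := h
  refine ⟨fun v => f (e v), fun X hX => ?_⟩
  rintro ⟨i, hi⟩
  have himage : ∀ Y : Set V, G.IsClique Y → H.IsClique (e '' Y) := by
    rintro Y hY _ ⟨u, hu, rfl⟩ _ ⟨v, hv, rfl⟩ hne
    exact e.map_adj_iff.2 (hY hu hv fun h => hne (h ▸ rfl))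
  have hpre : ∀ Y : Set W, H.IsClique Y → G.IsClique (e ⁻¹' Y) := fun Y hY u hu v hv hne =>
    e.map_adj_iff.1 (hY hu hv fun h => hne (e.injective h))
  refine hf (e '' X) ⟨himage X hX.1, fun Y hY hXY => ?_⟩ ⟨i, ?_⟩
  · have := hX.2 (hpre Y hY) (Set.image_subset_iff.1 hXY)
    intro w hw
    exact ⟨e.symm w, this (by simpa using hw), by simp⟩
  · rintro _ ⟨v, hv, rfl⟩
    exact hi v hv

/-! ### Graphs with parameter one -/

/-- For `ε ≥ 2` the base `2 - ε` is not positive, and the time bound is refuted on a single instance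
of parameter one. Parameter zero would not do, and neither would an even parameter with a negative
base. The claw serves the distance, since its center has degree three; an edge serves the other
parameter. -/
theorem distToLinearForest_star :
    (fromRel fun u _ : Fin 4 => u = 0).distToLinearForest = 1 := by
  have hG : (fromRel fun u _ : Fin 4 => u = 0).IsPathOutside {0} Fin.val :=
    ⟨fun u v _ _ => Fin.ext, fun u v hu hv huv => by simp_all⟩
  refine le_antisymm hG.distToLinearForest_le (Nat.one_le_iff_ne_zero.2 fun h => ?_)
  rw [distToLinearForest, Nat.sInf_eq_zero] at h
  rcases h with ⟨S, hS, -, h⟩ | h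
  · obtain rfl := Finset.card_eq_zero.1 hS
    have hsub : ({⟨1, by simp⟩, ⟨2, by simp⟩, ⟨3, by simp⟩} :
        Set {v : Fin 4 | v ∉ (∅ : Finset (Fin 4))}) ⊆
        ((fromRel fun u _ : Fin 4 => u = 0).induce {v | v ∉ (∅ : Finset (Fin 4))}).neighborSet
          ⟨0, by simp⟩ := by
      rintro _ (rfl | rfl | rfl) <;> simp
    have := (Set.encard_le_encard hsub).trans (h _)
    rw [Set.encard_insert_of_notMem (by simp), Set.encard_pair (by simp)] at this
    norm_num at this
  · exact Set.eq_empty_iff_forall_notMem.1 h _ ⟨_, rfl, hG.isLinearForest⟩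

theorem pathwidth_edge : (⊤ : SimpleGraph (Fin 2)).pathwidth = 1 ∧
    (⊤ : SimpleGraph (Fin 2)).feedbackVertexSetNumber = 0 := by
  have h : (⊤ : SimpleGraph (Fin 2)).IsPathOutside ∅ Fin.val :=
    ⟨fun u v _ _ => Fin.ext, fun u v _ _ huv => by
      have : u ≠ v := huv
      fin_cases u <;> fin_cases v <;> simp at *⟩
  refine ⟨le_antisymm h.pathwidth_le (Nat.one_le_iff_ne_zero.2 fun h₀ => ?_),
    Nat.le_zero.1 h.feedbackVertexSetNumber_le⟩
  rw [pathwidth, Nat.sInf_eq_zero] at h₀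
  rcases h₀ with ⟨m, B, hB, hcard⟩ | h₀
  · obtain ⟨i, h₁, h₂⟩ := hB.edge_mem 0 1 (by simp)
    exact absurd (Finset.card_le_one.1 (hcard i) _ h₁ _ h₂) (by simp)
  · exact Set.eq_empty_iff_forall_notMem.1 h₀ _ h.exists_isPathDecomposition

end SimpleGraph

/-! ### The parameters of the graph of the reduction -/

namespace SatGraph

open StackProg

variable {n : ℕ}

/-- The order of the vertices is a bijection. -/
noncomputable def isoFinGraph (cs : List (List (Fin n × Bool))) :
    (finGraph cs).graph ≃g clauseGraph cs where
  toEquiv := Equiv.ofBijective (verts n (tokens cs).length).get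
    ⟨List.nodup_iff_injective_get.1 nodup_verts, fun v => List.mem_iff_get.1 (mem_verts v)⟩
  map_rel_iff' := Iff.rfl

theorem cliqueColorable_finGraph_iff (cs : List (List (Fin n × Bool))) :
    (finGraph cs).graph.CliqueColorable 2 ↔
      ∃ asg : Fin n → Bool, ∀ C ∈ cs, ∃ l ∈ C, asg l.1 = l.2 := by
  rw [← cliqueColorable_clauseGraph_iff]
  exact ⟨.of_iso (isoFinGraph cs).symm, .of_iso (isoFinGraph cs)⟩

theorem pos_injective {m k : ℕ} {u v : Vert n m} (hu : pos u = some k) (hv : pos v = some k) :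
    u = v := by
  cases u <;> simp [pos] at hu <;> cases v <;> simp [pos] at hv <;>
    first
    | rfl
    | (rename_i j a j' a'
       obtain rfl : j = j' := Fin.ext (by lia)
       obtain rfl : a = a' := Fin.ext (by lia)
       rfl)
    | (exfalso; lia)

/-- The deleted vertices are the `n` variables and `P`, `Q`, `T`, `F`; `pos` provides the ranks of
the others. The default value 0 is taken only on deleted vertices. -/
theorem isPathOutside_finGraph (cs : List (List (Fin n × Bool))) :
    ∃ (D : Finset (Fin (finGraph cs).numVerts)) (r : Fin (finGraph cs).numVerts → ℕ),
      D.card ≤ n + 4 ∧ (finGraph cs).graph.IsPathOutside D r := by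
  classical
  let e := isoFinGraph cs
  let D₀ : Finset (Vert n (tokens cs).length) :=
    Finset.univ.image .x ∪ {.P, .Q, .T, .F}
  have hD₀ : D₀.card ≤ n + 4 := (Finset.card_union_le _ _).trans
    (Nat.add_le_add (Finset.card_image_le.trans (by simp)) Finset.card_le_four)
  have hpos : ∀ v, e v ∉ D₀ → pos (e v) = some ((pos (e v)).getD 0) := by
    intro v hv
    generalize e v = w at hv
    cases w <;> simp [D₀, pos] at hv ⊢
  refine ⟨D₀.image e.symm, fun v => (pos (e v)).getD 0, Finset.card_image_le.trans hD₀, ?_, ?_⟩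
  · intro u v hu hv huv
    have hu' := hpos u fun h => hu (Finset.mem_image.2 ⟨_, h, by simp⟩)
    have hv' := hpos v fun h => hv (Finset.mem_image.2 ⟨_, h, by simp⟩)
    rw [← huv] at hv'
    refine e.injective (pos_injective hu' hv')
  · intro u v hu hv huv
    have hu' := hpos u fun h => hu (Finset.mem_image.2 ⟨_, h, by simp⟩)
    have hv' := hpos v fun h => hv (Finset.mem_image.2 ⟨_, h, by simp⟩)
    exact pos_succ_of_adj hu' hv' (e.map_adj_iff.2 huv)

theorem distToLinearForest_finGraph_le (cs : List (List (Fin n × Bool))) :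
    (finGraph cs).graph.distToLinearForest ≤ n + 5 := by
  obtain ⟨D, r, hD, h⟩ := isPathOutside_finGraph cs
  exact h.distToLinearForest_le.trans (by lia)

theorem max_pathwidth_finGraph_le (cs : List (List (Fin n × Bool))) :
    max (finGraph cs).graph.pathwidth (finGraph cs).graph.feedbackVertexSetNumber ≤ n + 5 := by
  obtain ⟨D, r, hD, h⟩ := isPathOutside_finGraph cs
  exact max_le (h.pathwidth_le.trans (by lia)) (h.feedbackVertexSetNumber_le.trans (by lia))

end SatGraph

open StackProg SatGraph Turing

/-! ### Running times -/

/-- A machine takes at least one step, so the parameter cannot enter the running time with a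
nonpositive base. -/
theorem ParamProblem.not_solvableInOStar_of_nonpos {P : ParamProblem} {x : P.Instance}
    (hx : P.param x = 1) {b : ℝ} (hb : b ≤ 0) : ¬ P.SolvableInOStar b := by
  rintro ⟨M, C, c, h⟩
  obtain ⟨T, hT, ⟨⟨⟨k, hk⟩, hkT⟩⟩⟩ := h x
  have h₀ : (T : ℝ) ≤ 0 := hT.trans (by
    rw [hx, pow_one]
    exact mul_nonpos_of_nonpos_of_nonneg (mul_nonpos_of_nonneg_of_nonpos (by positivity) hb)
      (by positivity))
  obtain rfl : T = 0 := by exact_mod_cast h₀.antisymm (Nat.cast_nonneg T)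
  obtain rfl : k = 0 := Nat.le_zero.1 hkT
  -- Halting in zero steps is impossible: the initial configuration carries a label, the halting one
  -- none.
  have := congrArg TM2.Cfg.l (Option.some.inj hk)
  simp [initList, haltList] at this

theorem length_tokens_le {n : ℕ} (cs : List (List (Fin n × Bool))) :
    (tokens cs).length ≤ (encodeClauses cs).length := by
  have hC : ∀ C : List (Fin n × Bool), C.length ≤ (CNF.encodeClause C).length := by
    intro C
    induction C with
    | nil => simp
    | cons l C ih =>
      simp [CNF.encodeClause] at ih ⊢
      lia
  induction cs with
  | nil => simp [tokens]
  | cons C cs ih =>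
    have := hC C
    simp [tokens, encodeClauses] at ih ⊢
    lia

theorem FinGraph.length_encode (G : FinGraph) :
    G.encode.length = G.numVerts + 1 + G.numVerts * G.numVerts := by
  simp [FinGraph.encode, encodeUnary, List.length_flatMap]
  lia

/-- Solving a version of clique coloring in time `O*(b ^ t)` solves satisfiability in time
`O*(b ^ n)`, because the parameter of the graph of the reduction is at most `n + 5`. -/
theorem solvableInOStar_kSAT {P : ParamProblem} {b b' : ℝ} (hP : P.SolvableInOStar b) (hb : 0 ≤ b)
    (hbb' : b ≤ b') (hb'₁ : 1 ≤ b') (hb'₂ : b' ≤ 2) (given : Bool)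
    (hred : ∀ (n : ℕ) (cs : List (List (Fin n × Bool))), ∃ x : P.Instance,
      P.encode x = cond given (encodeUnary (n + 5)) [] ++ (finGraph cs).encode ∧
      (P.yes x ↔ (finGraph cs).graph.CliqueColorable 2) ∧ P.param x ≤ n + 5) (q : ℕ) :
    (kSAT q).SolvableInOStar b' := by
  obtain ⟨M, C, c, h⟩ := hP
  -- With `L` the input length, the reduction takes at most `1000 * (2 * L) ^ 3` steps and writes at
  -- most `100 * L ^ 2` bits; together with the transfer this fits into `8200 * L ^ 3`. The machine
  -- `M` contributes `100 ^ c * L ^ (2 * c)` for the length of its input and `b' ^ 5 ≤ 32` for the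
  -- excess of the parameter over `n`.
  refine ⟨⟨prependTM M.tm M.inputAlphabet (reduction given), Equiv.refl Bool, M.outputAlphabet⟩,
    8200 + C * 32 * 100 ^ c, 2 * c + 3, ?_⟩
  rintro ⟨⟨n, cs⟩, hcs⟩
  obtain ⟨x, hx, hyes, hparam⟩ := hred n cs
  obtain ⟨T, hT, hM⟩ := h x
  have henc : (kSAT q).encode ⟨⟨n, cs⟩, hcs⟩ = encodeUnary n ++ encodeClauses cs := by
    simp [kSAT, CNF.encode, encodeClauses]
  have hdec : @decide (P.yes x) (Classical.propDecidable _) =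
      @decide ((kSAT q).yes ⟨⟨n, cs⟩, hcs⟩) (Classical.propDecidable _) := by
    congr 1
    exact propext (hyes.trans (cliqueColorable_finGraph_iff cs))
  rw [hdec] at hM
  obtain ⟨L, hL⟩ : ∃ L, L = (encodeUnary n ++ encodeClauses cs).length := ⟨_, rfl⟩
  have hL' : L = n + 1 + (encodeClauses cs).length := by
    simp [hL, encodeUnary]
    lia
  have hcl : 1 ≤ (encodeClauses cs).length := by simp [encodeClauses]
  have htok := length_tokens_le cs
  obtain ⟨t, ht, hexec⟩ := run_reduction given cs L (by lia) (by lia) (by lia)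
  rw [← matrix_eq, List.append_assoc, ← encode_finGraph, ← hx] at hexec
  have hy : (P.encode x).length ≤ 100 * L ^ 2 := by
    have hN : (finGraph cs).numVerts ≤ 9 * L := by
      simp only [finGraph, length_verts]
      lia
    have hg : (cond given (encodeUnary (n + 5)) []).length ≤ 4 * L := by
      cases given
      · simp
      · simp [encodeUnary]
        lia
    rw [hx, List.length_append, FinGraph.length_encode]
    nlinarith
  refine ⟨t + ((P.encode x).length + 1) + T, ?_, ?_⟩
  · rw [henc, ← hL]
    have hL₁ : (1 : ℝ) ≤ L := by exact_mod_cast (by lia : 1 ≤ L)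
    have hy' : ((P.encode x).length : ℝ) ≤ 100 * (L : ℝ) ^ 2 := by exact_mod_cast hy
    have ht' : (t : ℝ) ≤ 8000 * (L : ℝ) ^ 3 := by
      have : t ≤ 1000 * (2 * L) ^ 3 :=
        ht.trans (Nat.mul_le_mul_left _ (Nat.pow_le_pow_left (by lia) 3))
      calc (t : ℝ) ≤ 1000 * (2 * L) ^ 3 := by exact_mod_cast this
        _ = _ := by ring
    have hpow : b ^ P.param x ≤ 32 * b' ^ n :=
      calc b ^ P.param x ≤ b' ^ P.param x := pow_le_pow_left₀ hb hbb' _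
        _ ≤ b' ^ (n + 5) := pow_le_pow_right₀ hb'₁ hparam
        _ = b' ^ 5 * b' ^ n := by ring
        _ ≤ 2 ^ 5 * b' ^ n := by gcongr
        _ = 32 * b' ^ n := by norm_num
    have hT' : (T : ℝ) ≤ C * 32 * 100 ^ c * b' ^ n * (L : ℝ) ^ (2 * c + 3) :=
      calc (T : ℝ) ≤ C * b ^ P.param x * ((P.encode x).length : ℝ) ^ c := hT
        _ ≤ C * (32 * b' ^ n) * (100 * (L : ℝ) ^ 2) ^ c := by gcongr
        _ = C * 32 * 100 ^ c * b' ^ n * (L : ℝ) ^ (2 * c) := by rw [mul_pow, ← pow_mul]; ring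
        _ ≤ _ := by gcongr; first | exact hL₁ | lia
    have h₁ : (t : ℝ) + ((P.encode x).length + 1) ≤ 8200 * (L : ℝ) ^ 3 := by
      have h₂ : (L : ℝ) ^ 2 ≤ (L : ℝ) ^ 3 := pow_le_pow_right₀ hL₁ (by lia)
      have h₃ : 1 ≤ (L : ℝ) ^ 3 := one_le_pow₀ hL₁
      linarith
    have h₂ : 8200 * (L : ℝ) ^ 3 ≤ 8200 * b' ^ n * (L : ℝ) ^ (2 * c + 3) := by
      have h₃ : (L : ℝ) ^ 3 ≤ (L : ℝ) ^ (2 * c + 3) := pow_le_pow_right₀ hL₁ (by lia)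
      have h₄ : 1 ≤ b' ^ n := one_le_pow₀ hb'₁
      have h₅ : 0 ≤ (L : ℝ) ^ (2 * c + 3) := by positivity
      nlinarith
    change ((t + ((P.encode x).length + 1) + T : ℕ) : ℝ) ≤
      ((8200 + C * 32 * 100 ^ c : ℕ) : ℝ) * b' ^ n * (L : ℝ) ^ (2 * c + 3)
    push_cast
    linarith
  · have hfin := outputsInTime_prepend M (reduction given) hexec hM
    have hid : ((kSAT q).encode ⟨⟨n, cs⟩, hcs⟩).map (Equiv.refl Bool).symm =
        encodeUnary n ++ encodeClauses cs := by
      rw [henc]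
      exact List.map_id _
    rw [← hid] at hfin
    exact hfin

/-- The hypothesis rules out every base below two. -/
theorem SETH.not_solvableInOStar (hSETH : SETH) {ε : ℝ} (hε : 0 < ε) {P : ParamProblem}
    {x₁ : P.Instance} (hx₁ : P.param x₁ = 1) (given : Bool)
    (hred : ∀ (n : ℕ) (cs : List (List (Fin n × Bool))), ∃ x : P.Instance,
      P.encode x = cond given (encodeUnary (n + 5)) [] ++ (finGraph cs).encode ∧
      (P.yes x ↔ (finGraph cs).graph.CliqueColorable 2) ∧ P.param x ≤ n + 5) :
    ¬ P.SolvableInOStar (2 - ε) := by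
  intro hP
  rcases le_or_gt (2 - ε) 0 with hb | hb
  · exact ParamProblem.not_solvableInOStar_of_nonpos hx₁ hb hP
  -- Replacing `ε` by `min ε 1` raises the base to at least one, so that a smaller parameter than `n
  -- + 5` only decreases the bound.
  · obtain ⟨q, hq⟩ := hSETH (min ε 1) (by positivity)
    have h₁ := min_le_left ε 1
    have h₂ := min_le_right ε 1
    have h₃ : 0 < min ε 1 := by positivity
    exact hq (solvableInOStar_kSAT hP hb.le (by linarith) (by linarith) (by linarith) given hred q)

theorem mainTheorem2 (hSETH : SETH) (ε : ℝ) (hε : 0 < ε) :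
    ¬ (cliqueColoring 2 fun G => G.graph.distToLinearForest).SolvableInOStar (2 - ε) ∧
    ¬ (cliqueColoringGiven 2 fun G => G.graph.distToLinearForest).SolvableInOStar (2 - ε) ∧
    ¬ (cliqueColoring 2 fun G =>
        max G.graph.pathwidth G.graph.feedbackVertexSetNumber).SolvableInOStar (2 - ε) ∧
    ¬ (cliqueColoringGiven 2 fun G =>
        max G.graph.pathwidth G.graph.feedbackVertexSetNumber).SolvableInOStar (2 - ε) := by
  have hdist : (FinGraph.mk 4 (.fromRel fun u _ => u = 0)).graph.distToLinearForest = 1 :=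
    SimpleGraph.distToLinearForest_star
  have hmax : max (FinGraph.mk 2 ⊤).graph.pathwidth (FinGraph.mk 2 ⊤).graph.feedbackVertexSetNumber
      = 1 := by
    simp [SimpleGraph.pathwidth_edge.1, SimpleGraph.pathwidth_edge.2]
  refine ⟨hSETH.not_solvableInOStar hε (x₁ := FinGraph.mk 4 (.fromRel fun u _ => u = 0)) hdist false
      fun n cs => ⟨finGraph cs, rfl, Iff.rfl, distToLinearForest_finGraph_le cs⟩,
    -- The upper bound `n + 5` itself is handed over as `t`, so the exact parameter never has to be
    -- computed.
    hSETH.not_solvableInOStar hε (x₁ := ⟨(_, 1), hdist.le⟩) rfl true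
      fun n cs => ⟨⟨(finGraph cs, n + 5), distToLinearForest_finGraph_le cs⟩, rfl, Iff.rfl, le_rfl⟩,
    hSETH.not_solvableInOStar hε (x₁ := FinGraph.mk 2 ⊤) hmax false
      fun n cs => ⟨finGraph cs, rfl, Iff.rfl, max_pathwidth_finGraph_le cs⟩,
    hSETH.not_solvableInOStar hε (x₁ := ⟨(_, 1), hmax.le⟩) rfl true
      fun n cs => ⟨⟨(finGraph cs, n + 5), max_pathwidth_finGraph_le cs⟩, rfl, Iff.rfl, le_rfl⟩⟩
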